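/- Let $F/\mathbb{F}_q$ be an algebraic function field of one variable with full constant field $\mathbb{F}_q$, and let $r_1,r_2\ge 1$ be integers. For $i=1,2$ let $H_i$ be a subgroup of $\mathrm{Aut}(F/\mathbb{F}_q)$ of order $r_i+1$ with fixed field $F_i=F^{H_i}$, and suppose that $G=H_1\rtimes H_2$ (internal semidirect product, $H_1$ normal) is a subgroup of $\mathrm{Aut}(F/\mathbb{F}_q)$; put $E=F^G$. Let $Q_1,\dots,Q_s$ be distinct rational places of $E$ that split completely in $F/E$, and let $\mathcal{P}=\{P_1,\dots,P_n\}$ be the set of all places of $F$ lying over some $Q_j$ (with $P_1,\dots,P_n$ distinct). Suppose that $w_1,w_2\in F$ satisfy, for $i=1,2$: 1. $1,w_i,w_i^2,\dots,w_i^{r_i-1}$ are linearly independent over $F_i$; 2. for every $P\in\mathcal{P}$, $w_i$ takes pairwise distinct values (in $\mathbb{F}_q\cup\{\infty\}$) at the places of $\{\sigma(P):\sigma\in H_i\}$. Let $1\le d\le n$ be an integer and let $D$ be an effective divisor of $F$ of degree $n-d$ with $\mathrm{supp}(D)\cap\mathcal{P}=\emptyset$ and $(r_i-1)(w_i)_\infty\le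 D$ for $i=1,2$, where $(w_i)_\infty$ is the pole divisor of $w_i$. Let $D_i$ be the largest effective divisor of $F_i$ such that $(r_i-1)(w_i)_\infty+\mathrm{Conorm}_{F/F_i}(D_i)\le D$, let $f_{i,1},\dots,f_{i,m_i}$ be an $\mathbb{F}_q$-basis of the Riemann–Roch space $\mathcal{L}(D_i)$, and put $$V_i=\Big\{\sum_{l=0}^{r_i-1}\Big(\sum_{j=1}^{m_i}c_{i,j,l}f_{i,j}\Big)w_i^l : c_{i,j,l}\in\mathbb{F}_q\Big\}\quad(i=1,2),\qquad V=V_1\cap V_2,$$ and assume $V\ne 0$. Then $n=s(r_1+1)(r_2+1)$, the places $P_1,\dots,P_n$ are rational, $V_1,V_2\subseteq\mathcal{L}(D)$, every $f\in V$ is regular at all the $P_j$, and the image of $$ev_{\mathcal{P}}:V\to\mathbb{F}_q^n,\qquad f\mapsto(f(P_1),\dots,f(P_n)),$$ is a linear code of length $n$, dimension $\dim_{\mathbb{F}_q}V$ and minimum distance at least $d$ that is locally repairable with availability $2$ and locality $(r_1,r_2)$; that is, writing $C$ for this code, for every coordinate $i$ there are disjoint sets $I_{i,1},I_{i,2}\subseteq\{1,\dots,n\}\setminus\{i\}$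 with $|I_{i,j}|\le r_j$ such that for all $\alpha\ne\beta$ in $\mathbb{F}_q$ the projections to the coordinates $I_{i,j}$ of $\{c\in C:c_i=\alpha\}$ and of $\{c\in C:c_i=\beta\}$ are disjoint ($j=1,2$). -/

import Mathlib

open scoped WithZero

noncomputable section

namespace FunctionFieldCode

/-! ### Function fields of one variable, places, divisors -/

/-- `F / k` is an algebraic function field of one variable whose full constant field is `k`:
`F` is a finite extension of `k(x)` for some `x ∈ F` transcendental over `k`, and every element
of `F` algebraic over `k` lies in `k`. -/
structure IsFunctionField (k F : Type*) [Field k] [Field F] [Algebra k F] : Prop where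
  exists_finite : ∃ x : F, Transcendental k x ∧ FiniteDimensional (IntermediateField.adjoin k {x}) F
  fullConstants : algebraicClosure k F = ⊥

/-- A place of `F / k`, given by its valuation ring: a discrete valuation ring of the field `F`
that contains `k`. (In a function field of one variable every valuation ring of `F / k` other
than `F` itself is discrete; a discrete valuation ring is not a field, so `F` is excluded.) -/
@[ext]
structure Place (k F : Type*) [Field k] [Field F] [Algebra k F] where
  /-- the valuation ring of the place -/
  ring : ValuationSubring F
  const_mem : ∀ a : k, algebraMap k F a ∈ ring
  discrete : IsDiscreteValuationRing ring

namespace Place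

variable {k F : Type*} [Field k] [Field F] [Algebra k F]

instance (P : Place k F) : IsDiscreteValuationRing P.ring := P.discrete

instance (P : Place k F) : Algebra k P.ring :=
  ((algebraMap k F).codRestrict P.ring.toSubring P.const_mem).toAlgebra

/-- The degree `[O_P / P : k]` of a place. -/
def degree (P : Place k F) : ℕ := Module.finrank k (IsLocalRing.ResidueField P.ring)

/-- A rational place: a place of degree one. -/
def IsRational (P : Place k F) : Prop := P.degree = 1

/-- The normalized discrete valuation of `P` on `F`, written multiplicatively
(it is `exp (- ν_P z)` at `z ≠ 0`, and `0` at `0`). -/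
def val (P : Place k F) : Valuation F ℤᵐ⁰ :=
  (IsDiscreteValuationRing.maximalIdeal P.ring).valuation F

/-- The normalized discrete valuation `ν_P(z)`, for `z ≠ 0` (the value at `0` is irrelevant). -/
def ord (P : Place k F) (z : F) : ℤ := -WithZero.log (P.val z)

/-- The coefficient at `P` of the pole divisor `(z)_∞`. -/
def poleOrder (P : Place k F) (z : F) : ℤ := max 0 (-P.ord z)

/-- `z` is regular at `P` and its residue class at `P` is that of the constant `a`,
i.e. `z - a` lies in the maximal ideal of `P`. -/
def HasValue (P : Place k F) (z : F) (a : k) : Prop :=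
  P.ring.valuation (z - algebraMap k F a) < 1

open Classical in
/-- The value `z(P) ∈ k` of a function `z` regular at a rational place `P`
(`0` by convention if there is no such value). -/
def value (P : Place k F) (z : F) : k := if h : ∃ a, P.HasValue z a then h.choose else 0

open Classical in
/-- The value `z(P) ∈ k ∪ {∞}` of an arbitrary function at a rational place,
equal to `∞` exactly when `z` has a pole at `P`. -/
def extValue (P : Place k F) (z : F) : OnePoint k :=
  if z ∈ P.ring then ((P.value z : k) : OnePoint k) else OnePoint.infty

/-- For a subextension `K` of `F / k`, the place `P` of `F` lies over the place `Q` of `K`: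
`O_Q = O_P ∩ K`. -/
def LiesOver {K : IntermediateField k F} (P : Place k F) (Q : Place k K) : Prop :=
  Q.ring = P.ring.comap (algebraMap K F)

/-- The ramification index `e(P|Q)` of a place `P` lying over `Q`: the number `e` with
`ν_P = e ν_Q` on `K`. -/
def ramificationIndex {K : IntermediateField k F} (P : Place k F) (Q : Place k K) : ℕ :=
  sInf {e : ℕ | ∀ x : K, P.ord (x : F) = e * Q.ord x}

/-- The place `Q` of `K` splits completely in `F`: there are exactly `[F : K]` places of `F`
over it (and `[F : K]` is finite). -/
def SplitsCompletely {K : IntermediateField k F} (Q : Place k K) : Prop :=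
  FiniteDimensional K F ∧ {P : Place k F | P.LiesOver Q}.ncard = Module.finrank K F

/-- The orbit `{σ(P) : σ ∈ H}` of a place, where `σ(P) = {σ z : z ∈ P}`; on valuation rings,
`O_{σ(P)} = σ(O_P)`. -/
def orbit (H : Subgroup (F ≃ₐ[k] F)) (P : Place k F) : Set (Place k F) :=
  {P' | ∃ σ ∈ H, ∀ z : F, σ z ∈ P'.ring ↔ z ∈ P.ring}

end Place

variable {k F : Type*} [Field k] [Field F] [Algebra k F]

/-- Divisors: finite formal integral combinations of places, ordered coefficientwise. -/
abbrev Divisor (k F : Type*) [Field k] [Field F] [Algebra k F] := Place k F →₀ ℤ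

/-- The degree `∑ D(P) deg P` of a divisor. -/
def Divisor.degree (D : Divisor k F) : ℤ := D.sum fun P a => a * P.degree

open Classical in
/-- The coefficient at `P` of the conorm `∑_Q A(Q) ∑_{P | Q} e(P|Q) P` of a divisor `A` of a
subextension `K`. -/
def Divisor.conormCoeff {K : IntermediateField k F} (A : Divisor k K) (P : Place k F) : ℤ :=
  A.sum fun Q a => if P.LiesOver Q then (P.ramificationIndex Q : ℤ) * a else 0

/-- The Riemann-Roch space `L(D) = {z ≠ 0 : (z) ≥ -D} ∪ {0}`. -/
def riemannRochSpace (D : Divisor k F) : Submodule k F where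
  carrier := {z | z = 0 ∨ ∀ P : Place k F, -D P ≤ P.ord z}
  zero_mem' := Or.inl rfl
  add_mem' := by
    intro a b ha hb
    by_cases hab : a + b = 0
    · exact Or.inl hab
    rcases ha with rfl | ha
    · simpa using hb
    rcases hb with rfl | hb
    · simpa using Or.inr ha
    by_cases ha0 : a = 0
    · subst ha0; simpa using Or.inr hb
    by_cases hb0 : b = 0
    · subst hb0; simpa using Or.inr ha
    refine Or.inr fun P => ?_
    have h1 := ha P
    have h2 := hb P
    have hadd := P.val.map_add a b
    unfold Place.ord at *
    have hn : ∀ z : F, z ≠ 0 → P.val z ≠ 0 := fun z hz => (P.val.ne_zero_iff).2 hz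
    rcases le_max_iff.1 hadd with h | h
    · have := (WithZero.log_le_log (hn _ hab) (hn _ ha0)).2 h
      linarith
    · have := (WithZero.log_le_log (hn _ hab) (hn _ hb0)).2 h
      linarith
  smul_mem' := by
    intro c z hz
    by_cases hc : c = 0
    · left; simp [hc]
    rcases hz with rfl | hz
    · left; simp
    by_cases hz0 : z = 0
    · left; simp [hz0]
    refine Or.inr fun P => ?_
    have hle : ∀ a : k, P.val (algebraMap k F a) ≤ 1 := fun a =>
      (IsDiscreteValuationRing.maximalIdeal P.ring).valuation_le_one (K := F)
        (⟨algebraMap k F a, P.const_mem a⟩ : P.ring)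
    have hc0 : algebraMap k F c ≠ 0 := by simpa using hc
    have h1 : P.val (algebraMap k F c) = 1 := by
      refine le_antisymm (hle c) ?_
      have := hle c⁻¹
      rw [map_inv₀, map_inv₀] at this
      have hpos : 0 < P.val (algebraMap k F c) := zero_lt_iff.2 ((P.val.ne_zero_iff).2 hc0)
      exact (inv_le_one₀ hpos).1 this
    have := hz P
    simpa [Place.ord, Algebra.smul_def, h1] using this

/-- The group `G` is the (internal) semidirect product `H₁ ⋊ H₂` of its subgroups `H₁`, `H₂`,
with `H₁` normal in `G`. -/
structure IsSemidirectProduct {A : Type*} [Group A] (G H₁ H₂ : Subgroup A) : Prop where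
  le_left : H₁ ≤ G
  le_right : H₂ ≤ G
  normal : ∀ g ∈ G, ∀ h ∈ H₁, g * h * g⁻¹ ∈ H₁
  inf_eq : H₁ ⊓ H₂ = ⊥
  exists_mul : ∀ g ∈ G, ∃ h₁ ∈ H₁, ∃ h₂ ∈ H₂, g = h₁ * h₂

/-- The `k`-subspace `{∑_{l < r} (∑_j c_{j,l} f_j) w^l : c_{j,l} ∈ k}` of `F`. -/
def functionSpace {m : ℕ} (f : Fin m → F) (w : F) (r : ℕ) : Submodule k F where
  carrier := {z | ∃ c : Fin m → Fin r → k, z = ∑ l : Fin r, (∑ j, c j l • f j) * w ^ (l : ℕ)}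
  zero_mem' := ⟨0, by simp⟩
  add_mem' := by
    rintro _ _ ⟨c, rfl⟩ ⟨c', rfl⟩
    exact ⟨c + c', by simp [add_smul, Finset.sum_add_distrib, add_mul]⟩
  smul_mem' := by
    rintro a _ ⟨c, rfl⟩
    refine ⟨a • c, ?_⟩
    simp [Finset.smul_sum, mul_smul, ← smul_mul_assoc]

/-- The evaluation map `f ↦ (f(P_1), …, f(P_n))`. -/
def evaluation {n : ℕ} (P : Fin n → Place k F) (f : F) : Fin n → k := fun j => (P j).value f

/-! ### Locally repairable codes -/

/-- `C(i, α)`: the codewords of `C` whose `i`-th coordinate is `α`. -/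
def codewordsWith {α : Type*} {n : ℕ} (C : Set (Fin n → α)) (i : Fin n) (a : α) :
    Set (Fin n → α) := {c ∈ C | c i = a}

/-- A code has availability `t` and locality `(r_1, …, r_t)` if every coordinate `i` has pairwise
disjoint recovering sets `I_1, …, I_t` not containing `i`, with `|I_j| ≤ r_j`, such that for
`a ≠ b` the projections of `C(i, a)` and `C(i, b)` to `I_j` are disjoint. -/
def IsLocallyRepairable {α : Type*} {n t : ℕ} (C : Set (Fin n → α)) (r : Fin t → ℕ) : Prop :=
  ∀ i : Fin n, ∃ I : Fin t → Finset (Fin n),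
    (∀ j j', j ≠ j' → Disjoint (I j) (I j')) ∧
    ∀ j, i ∉ I j ∧ (I j).card ≤ r j ∧
      ∀ a b : α, a ≠ b →
        Disjoint ((I j).restrict '' codewordsWith C i a) ((I j).restrict '' codewordsWith C i b)

open Classical in
/-- The minimum Hamming distance between distinct codewords of a code with at least two
codewords. -/
def minDist {α : Type*} {n : ℕ} (C : Set (Fin n → α)) : ℕ :=
  sInf {e | ∃ x ∈ C, ∃ y ∈ C, x ≠ y ∧ hammingDist x y = e}

/-- `C` is a linear `[n, K, ≥ d; (r_1, …, r_t)]` locally repairable code over `k`: a linear code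
of length `n`, dimension `K`, minimum distance at least `d`, availability `t` and locality
`(r_1, …, r_t)`. -/
structure IsLRC {n t : ℕ} (C : Submodule k (Fin n → k)) (K d : ℕ) (r : Fin t → ℕ) : Prop where
  finrank_eq : Module.finrank k C = K
  le_minDist : d ≤ minDist (C : Set (Fin n → k))
  locallyRepairable : IsLocallyRepairable (C : Set (Fin n → k)) r

end FunctionFieldCode

end

/-!
The stabilizer in `G` of each `P_j` is trivial, so the orbits of `P_j` under `H₁` and `H₂` have
`r₁ + 1` and `r₂ + 1` elements, and `H₁ ∩ H₂ = 1` makes them meet in `P_j` only: without `P_j` they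
are the two recovering sets. On the `H_i`-orbit of `P_j` the coefficients of `f ∈ V_i`, being fixed
by `H_i`, have constant values, so that `f` takes there the values of one polynomial of degree less
than `r_i` at the distinct values of `w_i`; when `f` vanishes at the other `r_i` places, this
polynomial is zero, and `f` vanishes at `P_j` too. Since a code is linear, this is local recovery.

The minimum distance comes from the bound `deg D` for the number of zeros of a nonzero function
`g ∈ L(D)`. Let `S` be a finite set of zeros of `g`. By weak approximation there are functions
`u_P`, `P ∈ S`, linearly independent over `k(g)`. If they lie in `L(C)`, the `(l + 1) |S|` functions
`g ^ j u_P`, `j ≤ l`, are linearly independent over `k` and lie in `L(l D + C)`, whose dimension is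
at most `l deg D + deg C + 1`; now let `l` grow.
-/

noncomputable section

namespace FunctionFieldCode

open Polynomial

variable {k F : Type*} [Field k] [Field F] [Algebra k F]

namespace Place

theorem val_le_one_iff (P : Place k F) (z : F) : P.val z ≤ 1 ↔ z ∈ P.ring := by
  refine ⟨fun h => ?_, fun h =>
    (IsDiscreteValuationRing.maximalIdeal P.ring).valuation_le_one (K := F) ⟨z, h⟩⟩
  obtain ⟨a, rfl⟩ := IsDiscreteValuationRing.exists_lift_of_le_one h
  exact a.2

theorem isEquiv_val (P : Place k F) : P.val.IsEquiv P.ring.valuation :=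
  Valuation.isEquiv_of_val_le_one fun {z} => by
    rw [val_le_one_iff, ValuationSubring.valuation_le_one_iff]

theorem val_lt_one_iff (P : Place k F) (z : F) : P.val z < 1 ↔ P.ring.valuation z < 1 :=
  P.isEquiv_val.lt_one_iff_lt_one

end Place

theorem map_aeval_le_one {Γ₀ : Type*} [LinearOrderedCommGroupWithZero Γ₀] (v : Valuation F Γ₀)
    [v.IsTrivialOn k] {y : F} (hy : v y ≤ 1) (p : k[X]) : v (aeval y p) ≤ 1 := by
  rw [aeval_eq_sum_range]
  refine v.map_sum_le fun i _ => ?_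
  rw [Algebra.smul_def, map_mul, map_pow]
  exact mul_le_one' (Valuation.IsTrivialOn.valuation_algebraMap_le_one v _) (pow_le_one' hy i)

namespace Place

instance (P : Place k F) : P.val.IsTrivialOn k :=
  .of_le_one _ fun a => (P.val_le_one_iff _).2 (P.const_mem a)

theorem val_algebraMap_lt_one_iff (P : Place k F) {a : k} :
    P.val (algebraMap k F a) < 1 ↔ a = 0 := by
  refine ⟨fun h => ?_, fun h => by simp [h]⟩
  by_contra ha
  exact h.ne (Valuation.IsTrivialOn.eq_one a ha)

theorem val_smul_le (P : Place k F) (a : k) (z : F) : P.val (a • z) ≤ P.val z := by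
  rw [Algebra.smul_def, map_mul]
  exact mul_le_of_le_one_left' (Valuation.IsTrivialOn.valuation_algebraMap_le_one _ a)

theorem val_smul (P : Place k F) {a : k} (ha : a ≠ 0) (z : F) : P.val (a • z) = P.val z := by
  rw [Algebra.smul_def, map_mul, Valuation.IsTrivialOn.eq_one a ha, one_mul]

theorem exists_val_eq (P : Place k F) (n : ℤ) : ∃ z : F, P.val z = WithZero.exp n :=
  (IsDiscreteValuationRing.maximalIdeal P.ring).valuation_surjective F (WithZero.exp n)

theorem neg_le_ord_iff (P : Place k F) {z : F} (hz : z ≠ 0) (a : ℤ) :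
    -a ≤ P.ord z ↔ P.val z ≤ WithZero.exp a := by
  rw [ord, neg_le_neg_iff, WithZero.log_le_iff_le_exp ((P.val.ne_zero_iff).2 hz)]

theorem val_eq_one_of_val_sub_one_lt_one (P : Place k F) {z : F} (h : P.val (z - 1) < 1) :
    P.val z = 1 := by
  simpa using P.val.map_one_add_of_lt h

theorem eq_of_forall_val_le_one {P Q : Place k F} (h : ∀ z, P.val z ≤ 1 → Q.val z ≤ 1) :
    P = Q := by
  ext z
  rw [← val_le_one_iff, ← val_le_one_iff]
  refine ⟨h z, fun hz => ?_⟩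
  by_contra! hz'
  have hz0 : z ≠ 0 := by rintro rfl; simp at hz'
  obtain ⟨y, hy⟩ := Q.exists_val_eq 1
  obtain ⟨n, hn⟩ := MulArchimedean.arch (P.val y) hz'
  have hyz : Q.val (y * z⁻¹ ^ n) ≤ 1 := h _ <| by
    rw [map_mul, map_pow, map_inv₀, inv_pow]
    exact mul_inv_le_one_of_le₀ hn zero_le
  have hy1 : Q.val y ≤ 1 := by
    rw [show y = y * z⁻¹ ^ n * z ^ n by
      rw [mul_assoc, ← mul_pow, inv_mul_cancel₀ hz0, one_pow, mul_one], map_mul, map_pow]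
    exact mul_le_one' hyz (pow_le_one' hz n)
  rw [hy, ← WithZero.exp_zero, WithZero.exp_le_exp] at hy1
  omega

end Place

theorem mem_riemannRochSpace_iff {D : Divisor k F} {z : F} :
    z ∈ riemannRochSpace D ↔ ∀ P : Place k F, P.val z ≤ WithZero.exp (D P) := by
  by_cases hz : z = 0
  · simp [hz]
  · change (z = 0 ∨ ∀ P : Place k F, -D P ≤ P.ord z) ↔ _
    simp only [hz, false_or, Place.neg_le_ord_iff _ hz]

/-! ### Weak approximation -/

namespace Place

theorem exists_val_lt_one_and_one_lt_val {P Q : Place k F} (h : P ≠ Q) :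
    ∃ z : F, P.val z < 1 ∧ 1 < Q.val z := by
  obtain ⟨a, ha, ha'⟩ : ∃ a, P.val a ≤ 1 ∧ 1 < Q.val a := by
    by_contra! hc
    exact h (eq_of_forall_val_le_one hc)
  obtain ⟨b, hb, hb'⟩ : ∃ b, Q.val b ≤ 1 ∧ 1 < P.val b := by
    by_contra! hc
    exact h (eq_of_forall_val_le_one hc).symm
  have hb0 : b ≠ 0 := by rintro rfl; simp at hb'
  refine ⟨a / b, ?_, ?_⟩ <;> rw [map_div₀]
  · exact (div_lt_one₀ (zero_lt_one.trans hb')).2 (ha.trans_lt hb')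
  · exact (one_lt_div₀ (zero_lt_iff.2 ((Q.val.ne_zero_iff).2 hb0))).2 (hb.trans_lt ha')

theorem eventually_one_lt_val_add_pow {Q : Place k F} {y z : F}
    (hyz : 1 < Q.val y ∨ 1 < Q.val z) : ∀ᶠ n in Filter.atTop, 1 < Q.val (y + z ^ n) := by
  rcases le_or_gt (Q.val z) 1 with h | h
  · have hy : 1 < Q.val y := hyz.resolve_right h.not_gt
    refine Filter.Eventually.of_forall fun n => ?_
    have hlt : Q.val (z ^ n) < Q.val y := by
      rw [map_pow]
      exact (pow_le_one' h n).trans_lt hy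
    rwa [Valuation.map_add_eq_of_lt_left _ hlt]
  · obtain ⟨N, hN⟩ := MulArchimedean.arch (Q.val y) h
    filter_upwards [Filter.eventually_gt_atTop N] with n hn
    have hlt : Q.val y < Q.val (z ^ n) := by
      rw [map_pow]
      exact hN.trans_lt (pow_lt_pow_right₀ h hn)
    rw [Valuation.map_add_eq_of_lt_right _ hlt, map_pow]
    exact one_lt_pow₀ h (by omega)

theorem exists_val_lt_one_and_forall_one_lt_val (P : Place k F) {S : Finset (Place k F)}
    (hP : P ∉ S) : ∃ z : F, P.val z < 1 ∧ ∀ Q ∈ S, 1 < Q.val z := by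
  classical
  induction S using Finset.induction_on with
  | empty => exact ⟨0, by simp, by simp⟩
  | insert R S hR ih =>
    rw [Finset.mem_insert, not_or] at hP
    obtain ⟨y, hy, hyS⟩ := ih hP.2
    obtain ⟨z, hz, hzR⟩ := exists_val_lt_one_and_one_lt_val hP.1
    have hyz : ∀ᶠ n in Filter.atTop, ∀ Q ∈ insert R S, 1 < Q.val (y + z ^ n) := by
      refine (Filter.eventually_all_finset _).2 fun Q hQ => eventually_one_lt_val_add_pow ?_
      rcases Finset.mem_insert.1 hQ with rfl | hQS
      exacts [Or.inr hzR, Or.inl (hyS Q hQS)]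
    obtain ⟨n, hn, hn0⟩ := (hyz.and (Filter.eventually_ne_atTop 0)).exists
    refine ⟨y + z ^ n, P.val.map_add_lt hy ?_, hn⟩
    rw [map_pow]
    exact pow_lt_one₀ zero_le hz hn0

theorem exists_val_sub_lt_one (P : Place k F) (S : Finset (Place k F)) {z : F}
    (hz : P.val z ≤ 1) : ∃ z', P.val (z' - z) < 1 ∧ ∀ Q ∈ S, Q ≠ P → Q.val z' < 1 := by
  classical
  obtain ⟨u, hu, huS⟩ := P.exists_val_lt_one_and_forall_one_lt_val (S.notMem_erase P)
  have hlt : ∀ᶠ n in Filter.atTop, ∀ Q ∈ S.erase P, Q.val z < Q.val (u ^ n) := by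
    refine (Filter.eventually_all_finset _).2 fun Q hQ => ?_
    obtain ⟨N, hN⟩ := MulArchimedean.arch (Q.val z) (huS Q hQ)
    filter_upwards [Filter.eventually_gt_atTop N] with n hn
    rw [map_pow]
    exact hN.trans_lt (pow_lt_pow_right₀ (huS Q hQ) hn)
  obtain ⟨n, hn, hn0⟩ := (hlt.and (Filter.eventually_ne_atTop 0)).exists
  have hun : P.val (u ^ n) < 1 := by
    rw [map_pow]
    exact pow_lt_one₀ zero_le hu hn0
  have hne : 1 + u ^ n ≠ 0 := by
    intro h
    simpa [h] using P.val.map_one_add_of_lt hun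
  refine ⟨z / (1 + u ^ n), ?_, fun Q hQ hQP => ?_⟩
  · rw [show z / (1 + u ^ n) - z = -(z * u ^ n / (1 + u ^ n)) by field_simp; ring,
      Valuation.map_neg, map_div₀, P.val.map_one_add_of_lt hun, div_one, map_mul]
    exact (mul_le_of_le_one_left' hz).trans_lt hun
  · have hQS : Q ∈ S.erase P := Finset.mem_erase.2 ⟨hQP, hQ⟩
    have hQu : 1 < Q.val (u ^ n) := by
      rw [map_pow]
      exact one_lt_pow₀ (huS Q hQS) hn0
    rw [map_div₀, Valuation.map_add_eq_of_lt_right _ (by simpa using hQu)]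
    exact (div_lt_one₀ (zero_lt_one.trans hQu)).2 (hn Q hQS)

end Place

/-! ### Linear independence over a rational function field -/

section LinearIndependence

variable {ι : Type*} [Fintype ι] {y : F} {u : ι → F}

theorem X_dvd_of_sum_aeval_mul_eq_zero
    (hu : ∀ c : ι → k, c ≠ 0 → ∃ P : Place k F, P.val y < 1 ∧ (∀ a, P.val (u a) ≤ 1) ∧
      1 ≤ P.val (∑ a, c a • u a))
    {p : ι → k[X]} (hp : ∑ a, aeval y (p a) * u a = 0) (a : ι) : X ∣ p a := by
  rw [X_dvd_iff]
  by_contra ha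
  obtain ⟨P, hy, hint, hsum⟩ := hu (fun a => (p a).coeff 0) fun h => ha (congrFun h a)
  have hred : ∑ a, (p a).coeff 0 • u a = -(y * ∑ a, aeval y (p a).divX * u a) := by
    rw [eq_neg_iff_add_eq_zero, ← hp, Finset.mul_sum, ← Finset.sum_add_distrib]
    refine Finset.sum_congr rfl fun a _ => ?_
    conv_rhs => rw [← divX_mul_X_add (p a)]
    simp only [map_add, map_mul, aeval_X, aeval_C, Algebra.smul_def]
    ring
  refine hsum.not_gt ?_
  rw [hred, Valuation.map_neg, map_mul]
  refine mul_lt_one_of_lt_of_le hy (P.val.map_sum_le fun a _ => ?_)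
  rw [map_mul]
  exact mul_le_one' (map_aeval_le_one P.val hy.le _) (hint a)

theorem linearIndependent_adjoin (hy : Transcendental k y)
    (hu : ∀ c : ι → k, c ≠ 0 → ∃ P : Place k F, P.val y < 1 ∧ (∀ a, P.val (u a) ≤ 1) ∧
      1 ≤ P.val (∑ a, c a • u a)) :
    LinearIndependent (IntermediateField.adjoin k {y}) u := by
  have hy0 : y ≠ 0 := by
    rintro rfl
    exact hy isAlgebraic_zero
  have hdvd (n : ℕ) : ∀ p : ι → k[X], ∑ a, aeval y (p a) * u a = 0 → ∀ a, X ^ n ∣ p a := by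
    induction n with
    | zero => simp
    | succ n ih =>
      intro p hp a
      choose q hq using X_dvd_of_sum_aeval_mul_eq_zero hu hp
      have hq0 : ∑ a, aeval y (q a) * u a = 0 := by
        refine (mul_eq_zero.1 ?_).resolve_left hy0
        simpa only [hq, map_mul, aeval_X, mul_assoc, ← Finset.mul_sum] using hp
      rw [hq a, pow_succ']
      exact mul_dvd_mul_left X (ih q hq0 a)
  open scoped IntermediateField.algebraAdjoinAdjoin in
  rw [← LinearIndependent.iff_fractionRing (R := Algebra.adjoin k {y}),
    Fintype.linearIndependent_iff]
  intro c hc a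
  have hmem (a : ι) : (c a : F) ∈ (aeval (R := k) y).range := by
    rw [← Algebra.adjoin_singleton_eq_range_aeval]
    exact (c a).2
  choose p hp using hmem
  have hpa : p a = 0 := by
    by_contra h
    refine (Polynomial.natDegree_le_of_dvd (hdvd ((p a).natDegree + 1) p ?_ a) h).not_gt (by simp)
    calc ∑ a, aeval y (p a) * u a = ∑ a, c a • u a :=
          Finset.sum_congr rfl fun a _ => congrArg (· * u a) (hp a)
      _ = 0 := hc
  exact Subtype.ext (by rw [← hp a, hpa, map_zero, ZeroMemClass.coe_zero])

end LinearIndependence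

namespace IsFunctionField

theorem essFiniteType (hF : IsFunctionField k F) : Algebra.EssFiniteType k F := by
  obtain ⟨x, -, hx⟩ := hF.exists_finite
  have : Algebra.EssFiniteType k (IntermediateField.adjoin k {x}) :=
    IntermediateField.essFiniteType_iff.2
      (IntermediateField.fg_adjoin_of_finite (Set.finite_singleton x))
  exact Algebra.EssFiniteType.comp k (IntermediateField.adjoin k {x}) F

theorem isAlgebraic_adjoin (hF : IsFunctionField k F) {y : F} (hy : Transcendental k y) :
    Algebra.IsAlgebraic (IntermediateField.adjoin k {y}) F := by
  obtain ⟨x, hx, hfin⟩ := hF.exists_finite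
  have hrange (z : F) : Set.range (fun _ : Fin 1 => z) = {z} := Set.range_const
  have hxb : IsTranscendenceBasis k (fun _ : Fin 1 => x) := by
    rw [(algebraicIndependent_unique_type_iff.2 hx).isTranscendenceBasis_iff_isAlgebraic, hrange]
    exact IntermediateField.isAlgebraic_adjoin_iff_top.1 inferInstance
  have hyb : IsTranscendenceBasis k (fun _ : Fin 1 => y) :=
    (algebraicIndependent_unique_type_iff.2 hy).isTranscendenceBasis_of_lift_trdeg_le_of_finite
      hxb.lift_cardinalMk_eq_trdeg.symm.le
  exact hrange y ▸ hyb.isAlgebraic_field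

theorem finiteDimensional_adjoin (hF : IsFunctionField k F) {y : F} (hy : Transcendental k y) :
    FiniteDimensional (IntermediateField.adjoin k {y}) F := by
  have := hF.isAlgebraic_adjoin hy
  have := hF.essFiniteType
  have : Algebra.EssFiniteType (IntermediateField.adjoin k {y}) F :=
    Algebra.EssFiniteType.of_comp k _ F
  exact Algebra.finite_of_essFiniteType_of_isAlgebraic

end IsFunctionField

/-! ### Zeros, poles and residue fields -/

theorem exists_separating (S : Finset (Place k F)) :
    ∃ u : S → F, (∀ P Q : S, P.1.val (u Q) ≤ 1) ∧
      ∀ (c : S → k) (P : S), c P ≠ 0 → 1 ≤ P.1.val (∑ Q, c Q • u Q) := by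
  choose u hu hu' using fun P : S => P.1.exists_val_sub_lt_one S (map_one _).le
  have hself (P : S) : P.1.val (u P) = 1 := P.1.val_eq_one_of_val_sub_one_lt_one (hu P)
  have hlt {P Q : S} (h : Q ≠ P) : P.1.val (u Q) < 1 :=
    hu' Q P P.2 fun h' => h (Subtype.ext h'.symm)
  refine ⟨u, fun P Q => ?_, fun c P hc => ?_⟩
  · rcases eq_or_ne Q P with rfl | h
    exacts [(hself _).le, (hlt h).le]
  · classical
    have hP : P.1.val (c P • u P) = 1 := by rw [P.1.val_smul hc, hself]
    rw [Valuation.map_sum_eq_of_lt _ (Finset.mem_univ P), hP]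
    intro Q hQ
    rw [hP]
    exact (P.1.val_smul_le _ _).trans_lt (hlt (by simpa using hQ))

theorem exists_linearIndependent_of_zeros {y : F} (hy : Transcendental k y)
    (S : Finset (Place k F)) (hS : ∀ P ∈ S, P.val y < 1) :
    ∃ u : S → F, LinearIndependent (IntermediateField.adjoin k {y}) u := by
  obtain ⟨u, hint, hsum⟩ := exists_separating S
  refine ⟨u, linearIndependent_adjoin hy fun c hc => ?_⟩
  obtain ⟨P, hP⟩ := Function.ne_iff.1 hc
  exact ⟨P, hS P P.2, hint P, hsum c P hP⟩

namespace Place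

theorem residue_eq_zero_iff (P : Place k F) (z : P.ring) :
    IsLocalRing.residue P.ring z = 0 ↔ P.val (z : F) < 1 := by
  rw [IsLocalRing.residue_eq_zero_iff, val_lt_one_iff, ValuationSubring.valuation_lt_one_iff]

/-- The inclusion of the valuation ring of a place into the function field, as a `k`-linear map. -/
def subtypeₗ (P : Place k F) : P.ring →ₗ[k] F where
  toFun := (↑)
  map_add' _ _ := rfl
  map_smul' a z := by
    rw [Algebra.smul_def, RingHom.id_apply, Algebra.smul_def]
    rfl

/-- The residue map of a place, as a `k`-linear map. -/
def residueₗ (P : Place k F) : P.ring →ₗ[k] IsLocalRing.ResidueField P.ring :=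
  (IsScalarTower.toAlgHom k P.ring (IsLocalRing.ResidueField P.ring)).toLinearMap

theorem linearIndependent_of_residue {P : Place k F} {y : F} (hy : Transcendental k y)
    (hyP : P.val y < 1) {ι : Type*} [Finite ι] {u : ι → P.ring}
    (hu : LinearIndependent k fun a => IsLocalRing.residue P.ring (u a)) :
    LinearIndependent (IntermediateField.adjoin k {y}) fun a => (u a : F) := by
  have := Fintype.ofFinite ι
  refine linearIndependent_adjoin hy fun c hc =>
    ⟨P, hyP, fun a => (P.val_le_one_iff _).2 (u a).2, ?_⟩
  by_contra! hlt
  have hcoe : ∑ a, c a • (u a : F) = P.subtypeₗ (∑ a, c a • u a) := by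
    simp only [map_sum, map_smul]
    rfl
  rw [hcoe] at hlt
  have hres : P.residueₗ (∑ a, c a • u a) = 0 := (P.residue_eq_zero_iff _).2 hlt
  rw [map_sum] at hres
  simp only [map_smul] at hres
  exact hc (funext (Fintype.linearIndependent_iff.1 hu c hres))

theorem exists_transcendental_val_lt_one (P : Place k F) :
    ∃ y : F, P.val y < 1 ∧ Transcendental k y := by
  obtain ⟨y, hy⟩ := P.exists_val_eq (-1)
  have hy1 : P.val y < 1 := by
    rw [hy, ← WithZero.exp_zero, WithZero.exp_lt_exp]
    norm_num
  have hy0 : y ≠ 0 := by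
    rintro rfl
    exact WithZero.exp_ne_zero (hy.symm.trans P.val.map_zero)
  exact ⟨y, hy1, Valuation.transcendental_of_ne_one k y hy0 hy1.ne⟩

end Place

namespace IsFunctionField

theorem finite_zeros (hF : IsFunctionField k F) {y : F} (hy : Transcendental k y) :
    {P : Place k F | P.val y < 1}.Finite := by
  have := hF.finiteDimensional_adjoin hy
  by_contra hinf
  obtain ⟨S, hS, hcard⟩ := Set.Infinite.exists_subset_card_eq hinf
    (Module.finrank (IntermediateField.adjoin k {y}) F + 1)
  obtain ⟨u, hu⟩ := exists_linearIndependent_of_zeros hy S fun P hP => hS hP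
  simpa [hcard] using hu.fintype_card_le_finrank

theorem finite_poles (hF : IsFunctionField k F) (z : F) :
    {P : Place k F | 1 < P.val z}.Finite := by
  rcases eq_or_ne z 0 with rfl | hz
  · simp
  rcases Set.eq_empty_or_nonempty {P : Place k F | 1 < P.val z} with hpole | ⟨P, hP⟩
  · rw [hpole]
    exact Set.finite_empty
  · have hinv {P : Place k F} (hP : 1 < P.val z) : P.val z⁻¹ < 1 := by
      rw [map_inv₀]
      exact inv_lt_one_of_one_lt₀ hP
    exact (hF.finite_zeros (Valuation.transcendental_of_ne_one k _ (inv_ne_zero hz)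
      (hinv hP).ne)).subset fun P => hinv

theorem finiteDimensional_residueField (hF : IsFunctionField k F) (P : Place k F) :
    FiniteDimensional k (IsLocalRing.ResidueField P.ring) := by
  obtain ⟨y, hyP, hy⟩ := P.exists_transcendental_val_lt_one
  have := hF.finiteDimensional_adjoin hy
  by_contra hinf
  have hrank : ((Module.finrank (IntermediateField.adjoin k {y}) F + 1 : ℕ) : Cardinal) ≤
      Module.rank k (IsLocalRing.ResidueField P.ring) :=
    Cardinal.natCast_lt_aleph0.le.trans (not_lt.1 fun h => hinf (Module.rank_lt_aleph0_iff.1 h))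
  obtain ⟨b, hb⟩ := le_rank_iff_exists_linearIndependent_finset.1 hrank
  choose u hu using fun a : b => IsLocalRing.residue_surjective a.1
  have hli := Place.linearIndependent_of_residue hy hyP (u := u) (by rw [funext hu]; exact hb.2)
  simpa [hb.1] using hli.fintype_card_le_finrank

end IsFunctionField

/-! ### Existence of poles -/

theorem isDiscreteValuationRing_of_isCyclic {Γ₀ : Type*} [LinearOrderedCommGroupWithZero Γ₀]
    [IsCyclic Γ₀ˣ] (v : Valuation F Γ₀) {x : F} (hx : 1 < v x) :
    IsDiscreteValuationRing v.valuationSubring := by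
  have hnontrivial : Nontrivial (MonoidWithZeroHom.ofClass v).valueGroup := by
    rw [Subgroup.nontrivial_iff_exists_ne_one]
    exact ⟨Units.mk0 (v x) (zero_lt_one.trans hx).ne', MonoidWithZeroHom.mem_valueGroup _ ⟨x, rfl⟩,
      fun h => hx.ne' (congrArg Units.val h)⟩
  exact v.valuationSubring_isDiscreteValuationRing

theorem exists_ne_map_eq_of_sum_eq_zero {Γ₀ : Type*} [LinearOrderedCommGroupWithZero Γ₀]
    (v : Valuation F Γ₀) {ι : Type*} {s : Finset ι} {f : ι → F} (hsum : ∑ i ∈ s, f i = 0)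
    (hne : ∃ i ∈ s, f i ≠ 0) : ∃ i ∈ s, ∃ j ∈ s, i ≠ j ∧ f i ≠ 0 ∧ v (f i) = v (f j) := by
  classical
  obtain ⟨i₀, hi₀, hf⟩ := hne
  obtain ⟨i, hi, hmax⟩ := s.exists_max_image (fun i => v (f i)) ⟨i₀, hi₀⟩
  have hi0 : f i ≠ 0 := fun h => hf <| by
    simpa only [h, map_zero, le_zero_iff, map_eq_zero] using hmax i₀ hi₀
  by_contra! hdist
  have hlt : v (∑ j ∈ s, f j) = v (f i) := Valuation.map_sum_eq_of_lt _ hi fun j hj => by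
    rw [Finset.mem_sdiff, Finset.mem_singleton] at hj
    exact (hmax j hj.1).lt_of_ne (hdist i hi j hj.1 (Ne.symm hj.2) hi0).symm
  rw [hsum, map_zero, eq_comm, map_eq_zero] at hlt
  exact hi0 hlt

section TrivialOnConstants

variable {Γ₀ : Type*} [LinearOrderedCommGroupWithZero Γ₀] (v : Valuation F Γ₀) [v.IsTrivialOn k]

theorem exists_map_eq_zpow_of_mem_adjoin {y : F} (hy : 1 < v y)
    {c : F} (hc : c ∈ IntermediateField.adjoin k {y}) (hc0 : c ≠ 0) : ∃ m : ℤ, v c = v y ^ m := by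
  obtain ⟨p, q, rfl⟩ := (IntermediateField.mem_adjoin_simple_iff k c).1 hc
  obtain ⟨hp, hq⟩ := div_ne_zero_iff.1 hc0
  refine ⟨p.natDegree - q.natDegree, ?_⟩
  rw [map_div₀,
    valuation_aeval_eq_valuation_X_pow_natDegree_of_one_lt_valuation_X y hy
      (by rintro rfl; simp at hp),
    valuation_aeval_eq_valuation_X_pow_natDegree_of_one_lt_valuation_X y hy
      (by rintro rfl; simp at hq), zpow_sub₀ (zero_lt_one.trans hy).ne', zpow_natCast,
    zpow_natCast]

theorem exists_map_pow_eq_zpow {y : F} [FiniteDimensional (IntermediateField.adjoin k {y}) F]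
    (hy : 1 < v y) {x : F} (hx : x ≠ 0) :
    ∃ i, 0 < i ∧ i ≤ Module.finrank (IntermediateField.adjoin k {y}) F ∧
      ∃ m : ℤ, v x ^ i = v y ^ m := by
  set N := Module.finrank (IntermediateField.adjoin k {y}) F with hN
  have hdep : ¬ LinearIndependent (IntermediateField.adjoin k {y})
      fun i : Fin (N + 1) => x ^ (i : ℕ) := fun h => by
    simpa [hN] using h.fintype_card_le_finrank
  obtain ⟨g, hg, i₀, hi₀⟩ := Fintype.not_linearIndependent_iff.1 hdep
  have hterm (i : Fin (N + 1)) : g i • x ^ (i : ℕ) = (g i : F) * x ^ (i : ℕ) := rfl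
  obtain ⟨i, -, j, -, hij, hi0, hval⟩ := exists_ne_map_eq_of_sum_eq_zero v hg
    ⟨i₀, Finset.mem_univ _, smul_ne_zero hi₀ (pow_ne_zero _ hx)⟩
  have hj0 : g j • x ^ (j : ℕ) ≠ 0 := by
    rwa [← v.ne_zero_iff, ← hval, v.ne_zero_iff]
  wlog hlt : i < j generalizing i j
  · exact this j i hij.symm hj0 hval.symm hi0 (hij.symm.lt_of_le (not_lt.1 hlt))
  rw [hterm] at hi0 hj0
  obtain ⟨a, ha⟩ := exists_map_eq_zpow_of_mem_adjoin v hy (g i).2 (left_ne_zero_of_mul hi0)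
  obtain ⟨b, hb⟩ := exists_map_eq_zpow_of_mem_adjoin v hy (g j).2 (left_ne_zero_of_mul hj0)
  refine ⟨j - i, by omega, by omega, a - b, ?_⟩
  have hvy : v y ≠ 0 := (zero_lt_one.trans hy).ne'
  have hvx : v x ≠ 0 := v.ne_zero_iff.2 hx
  rw [hterm, hterm, map_mul, map_mul, map_pow, map_pow, ha, hb] at hval
  rw [pow_sub₀ _ hvx hlt.le, zpow_sub₀ hvy, ← div_eq_mul_inv,
    div_eq_div_iff (pow_ne_zero _ hvx) (zpow_ne_zero _ hvy), mul_comm, hval.symm]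

theorem isCyclic_units_of_surjective {y : F}
    [FiniteDimensional (IntermediateField.adjoin k {y}) F] (hy : 1 < v y)
    (hv : Function.Surjective v) : IsCyclic Γ₀ˣ := by
  let N := Module.finrank (IntermediateField.adjoin k {y}) F
  let γ : Γ₀ˣ := Units.mk0 (v y) (zero_lt_one.trans hy).ne'
  have hmem (δ : Γ₀ˣ) : powMonoidHom N.factorial δ ∈ Subgroup.zpowers γ := by
    obtain ⟨x, hx⟩ := hv δ
    obtain ⟨i, hi, hiN, m, hm⟩ := exists_map_pow_eq_zpow (k := k) v hy
      (v.ne_zero_iff.1 (hx ▸ δ.ne_zero))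
    have hδ : δ ^ i = γ ^ m := Units.ext (by simpa [γ, hx] using hm)
    obtain ⟨c, hc⟩ := Nat.dvd_factorial hi hiN
    rw [powMonoidHom_apply, hc, pow_mul, hδ]
    exact pow_mem (zpow_mem (Subgroup.mem_zpowers γ) m) c
  refine isCyclic_of_injective ((powMonoidHom N.factorial).codRestrict _ hmem) fun a b h => ?_
  exact pow_left_injective N.factorial_ne_zero (congrArg Subtype.val h)

end TrivialOnConstants

namespace IsFunctionField

theorem isDiscreteValuationRing (hF : IsFunctionField k F) (V : ValuationSubring F)
    (hk : ∀ a : k, algebraMap k F a ∈ V) {x : F} (hx : x ∉ V) : IsDiscreteValuationRing V := by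
  have := Valuation.IsTrivialOn.of_le_one V.valuation fun a => (V.valuation_le_one_iff _).2 (hk a)
  have hx1 : 1 < V.valuation x := by rwa [← not_le, V.valuation_le_one_iff]
  have hx0 : x ≠ 0 := fun h => hx (h ▸ V.zero_mem)
  have := hF.finiteDimensional_adjoin (Valuation.transcendental_of_ne_one k x hx0 hx1.ne')
  have := isCyclic_units_of_surjective (k := k) V.valuation hx1 V.valuation_surjective
  rw [← V.valuationSubring_valuation]
  exact isDiscreteValuationRing_of_isCyclic _ hx1

theorem exists_one_lt_val (hF : IsFunctionField k F) {z : F} (hz : ∀ a, algebraMap k F a ≠ z) :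
    ∃ P : Place k F, 1 < P.val z := by
  have hz' : z ∉ (⊥ : Subalgebra k F).toSubring := by
    intro h
    obtain ⟨a, ha⟩ := Algebra.mem_bot.1 h
    exact hz a ha
  have hclosed : IsIntegrallyClosedIn (⊥ : Subalgebra k F).toSubring F := by
    rw [Subring.isIntegrallyClosedIn_iff]
    intro x hx
    have hx' : x ∈ algebraicClosure k F := mem_algebraicClosure_iff.2
      (isIntegral_trans (A := (⊥ : Subalgebra k F)) x hx).isAlgebraic
    rwa [hF.fullConstants] at hx'
  obtain ⟨V, hV, hzV⟩ := Subring.exists_le_valuationSubring_of_isIntegrallyClosedIn hz'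
  have hk (a : k) : algebraMap k F a ∈ V := hV (Subalgebra.algebraMap_mem ⊥ a)
  refine ⟨⟨V, hk, hF.isDiscreteValuationRing V hk hzV⟩, ?_⟩
  rwa [← not_le, Place.val_le_one_iff]

end IsFunctionField

/-! ### Riemann-Roch spaces -/

namespace Divisor

theorem degree_add (A B : Divisor k F) : (A + B).degree = A.degree + B.degree :=
  Finsupp.sum_add_index' (by simp) fun P a b => by ring

theorem degree_single (P : Place k F) (a : ℤ) :
    degree (Finsupp.single P a : Divisor k F) = a * P.degree :=
  Finsupp.sum_single_index (zero_mul _)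

theorem degree_nsmul (n : ℕ) (A : Divisor k F) : (n • A).degree = n * A.degree := by
  rw [degree, Finsupp.sum_smul_index' (by simp), degree, Finsupp.mul_sum]
  simp only [nsmul_eq_mul, mul_assoc]

theorem degree_nonneg {A : Divisor k F} (hA : 0 ≤ A) : 0 ≤ A.degree :=
  Finset.sum_nonneg fun P _ => mul_nonneg (hA P) (Nat.cast_nonneg _)

theorem induction_of_nonneg {p : Divisor k F → Prop} (zero : p 0)
    (add_single : ∀ A P, p A → p (A + Finsupp.single P 1))
    (A : Divisor k F) (hA : 0 ≤ A) : p A := by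
  have hmem : A ∈ AddSubmonoid.closure
      (Set.range fun P : Place k F => Finsupp.single P (1 : ℤ)) := by
    rw [← A.sum_single]
    refine AddSubmonoid.sum_mem _ fun P _ => ?_
    have hsingle : Finsupp.single P (A P) = (A P).toNat • Finsupp.single P 1 := by
      rw [Finsupp.smul_single, nsmul_one, Int.natCast_toNat_eq_self.2 (hA P)]
    rw [hsingle]
    exact nsmul_mem (AddSubmonoid.subset_closure (Set.mem_range_self P)) _
  clear hA
  induction hmem using AddSubmonoid.closure_induction_right with
  | zero => exact zero
  | add_right A _ _ hy ih =>
    obtain ⟨P, rfl⟩ := hy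
    exact add_single A P ih

end Divisor

section RiemannRochSpace

variable {A B : Divisor k F} {a b : F}

theorem riemannRochSpace_mono (h : A ≤ B) : riemannRochSpace A ≤ riemannRochSpace B := by
  intro z hz
  rw [mem_riemannRochSpace_iff] at hz ⊢
  exact fun P => (hz P).trans (WithZero.exp_le_exp.2 (h P))

theorem mul_mem_riemannRochSpace (ha : a ∈ riemannRochSpace A) (hb : b ∈ riemannRochSpace B) :
    a * b ∈ riemannRochSpace (A + B) := by
  rw [mem_riemannRochSpace_iff] at ha hb ⊢
  intro P
  rw [map_mul, Finsupp.add_apply, WithZero.exp_add]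
  exact mul_le_mul' (ha P) (hb P)

theorem pow_mem_riemannRochSpace (ha : a ∈ riemannRochSpace A) (n : ℕ) :
    a ^ n ∈ riemannRochSpace (n • A) := by
  rw [mem_riemannRochSpace_iff] at ha ⊢
  intro P
  rw [map_pow, Finsupp.smul_apply, WithZero.exp_nsmul]
  exact pow_le_pow_left' (ha P) n

theorem IsFunctionField.riemannRochSpace_zero_le (hF : IsFunctionField k F) :
    riemannRochSpace (0 : Divisor k F) ≤ Submodule.span k {1} := by
  intro z hz
  rw [mem_riemannRochSpace_iff] at hz
  by_contra h
  obtain ⟨P, hP⟩ := hF.exists_one_lt_val (z := z) fun a ha => h <| Submodule.mem_span_singleton.2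
    ⟨a, by rw [← ha, Algebra.algebraMap_eq_smul_one]⟩
  exact (hz P).not_gt hP

theorem IsFunctionField.exists_mem_riemannRochSpace (hF : IsFunctionField k F) (z : F) :
    ∃ A : Divisor k F, 0 ≤ A ∧ z ∈ riemannRochSpace A := by
  rcases eq_or_ne z 0 with rfl | hz
  · exact ⟨0, le_rfl, zero_mem _⟩
  have hlog (P : Place k F) (a : ℤ) : WithZero.log (P.val z) ≤ a ↔ P.val z ≤ WithZero.exp a :=
    WithZero.log_le_iff_le_exp ((P.val.ne_zero_iff).2 hz)
  have hfin : (Function.support fun P : Place k F => max 0 (WithZero.log (P.val z))).Finite := by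
    refine (hF.finite_poles z).subset fun P hP => ?_
    by_contra h
    rw [Set.mem_ofPred_eq, not_lt, ← WithZero.exp_zero, ← hlog] at h
    exact hP (max_eq_left h)
  refine ⟨Finsupp.ofSupportFinite _ hfin, fun P => le_max_left _ _, ?_⟩
  rw [mem_riemannRochSpace_iff]
  exact fun P => (hlog P _).1 (le_max_right _ _)

theorem IsFunctionField.exists_forall_mem_riemannRochSpace (hF : IsFunctionField k F)
    {ι : Type*} [Finite ι] (u : ι → F) :
    ∃ A : Divisor k F, 0 ≤ A ∧ ∀ i, u i ∈ riemannRochSpace A := by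
  have := Fintype.ofFinite ι
  choose A hA huA using fun i => hF.exists_mem_riemannRochSpace (u i)
  exact ⟨∑ i, A i, Finset.sum_nonneg fun i _ => hA i, fun i =>
    riemannRochSpace_mono (Finset.single_le_sum (fun i _ => hA i) (Finset.mem_univ i)) (huA i)⟩

end RiemannRochSpace

/-- For `t` of order `A(P) + 1` at `P`, the map `L(A + P) → O_P / P`, `z ↦ (t z)(P)`. Its kernel is
contained in `L(A)`, so that adding `P` to a divisor raises the dimension by at most `deg P`. -/
def leadingCoeffMap {A : Divisor k F} {P : Place k F} {t : F}
    (ht : P.val t = WithZero.exp (-(A P + 1))) :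
    riemannRochSpace (A + Finsupp.single P 1) →ₗ[k] IsLocalRing.ResidueField P.ring :=
  P.residueₗ ∘ₗ
  { toFun := fun z => ⟨t * z, by
      have hz := mem_riemannRochSpace_iff.1 z.2 P
      rw [← P.val_le_one_iff, map_mul, ht]
      refine (mul_le_mul_right hz _).trans ?_
      rw [← WithZero.exp_add]
      simp⟩
    map_add' := fun _ _ => Subtype.ext (by simp [mul_add])
    map_smul' := fun a z => Subtype.ext <| by
      change t * (a • (z : F)) = P.subtypeₗ (a • ⟨t * z, _⟩)
      rw [map_smul, mul_smul_comm]
      rfl }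

theorem mem_of_leadingCoeffMap_eq_zero {A : Divisor k F} {P : Place k F} {t : F}
    (ht : P.val t = WithZero.exp (-(A P + 1))) {z : riemannRochSpace (A + Finsupp.single P 1)}
    (hz : leadingCoeffMap ht z = 0) : (z : F) ∈ riemannRochSpace A := by
  rw [mem_riemannRochSpace_iff]
  intro Q
  rcases eq_or_ne P Q with rfl | hQ
  · rcases eq_or_ne (z : F) 0 with hz0 | hz0
    · simp [hz0]
    have hval : P.val (z : F) ≠ 0 := (P.val.ne_zero_iff).2 hz0
    have hlt : P.val (t * z) < 1 := (P.residue_eq_zero_iff _).1 hz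
    rw [map_mul, ht, ← WithZero.exp_log hval, ← WithZero.exp_add, ← WithZero.exp_zero,
      WithZero.exp_lt_exp] at hlt
    rw [← WithZero.log_le_iff_le_exp hval]
    omega
  · simpa [hQ] using mem_riemannRochSpace_iff.1 z.2 Q

namespace IsFunctionField

theorem finrank_riemannRochSpace_add_single_le (hF : IsFunctionField k F) (A : Divisor k F)
    (P : Place k F) [FiniteDimensional k (riemannRochSpace A)] :
    FiniteDimensional k (riemannRochSpace (A + Finsupp.single P 1)) ∧
      Module.finrank k (riemannRochSpace (A + Finsupp.single P 1)) ≤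
        Module.finrank k (riemannRochSpace A) + P.degree := by
  have := hF.finiteDimensional_residueField P
  obtain ⟨t, ht⟩ := P.exists_val_eq (-(A P + 1))
  let φ := leadingCoeffMap ht
  let ψ : LinearMap.ker φ →ₗ[k] riemannRochSpace A :=
    ((riemannRochSpace (A + Finsupp.single P 1)).subtype ∘ₗ (LinearMap.ker φ).subtype).codRestrict _
      fun z => mem_of_leadingCoeffMap_eq_zero ht z.2
  have hψ : Function.Injective ψ := fun a b h =>
    Subtype.ext (Subtype.ext (congrArg (fun x : riemannRochSpace A => (x : F)) h))
  have : FiniteDimensional k (LinearMap.ker φ) := FiniteDimensional.of_injective ψ hψ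
  have := Module.Finite.equiv φ.quotKerEquivRange.symm
  have hfin := Module.Finite.of_submodule_quotient (LinearMap.ker φ)
  refine ⟨hfin, ?_⟩
  rw [← LinearMap.finrank_range_add_finrank_ker φ, add_comm]
  exact add_le_add (LinearMap.finrank_le_finrank_of_injective hψ) (Submodule.finrank_le _)

theorem finrank_riemannRochSpace_le (hF : IsFunctionField k F) {A : Divisor k F} (hA : 0 ≤ A) :
    FiniteDimensional k (riemannRochSpace A) ∧
      (Module.finrank k (riemannRochSpace A) : ℤ) ≤ A.degree + 1 := by
  refine Divisor.induction_of_nonneg (p := fun A => FiniteDimensional k (riemannRochSpace A) ∧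
    (Module.finrank k (riemannRochSpace A) : ℤ) ≤ A.degree + 1) ?_ ?_ A hA
  · have hle := (Submodule.finrank_mono hF.riemannRochSpace_zero_le).trans
      (finrank_span_singleton one_ne_zero).le
    exact ⟨Submodule.finiteDimensional_of_le hF.riemannRochSpace_zero_le, by
      simpa [Divisor.degree] using hle⟩
  · rintro A P ⟨_, hA⟩
    obtain ⟨hfin, hle⟩ := hF.finrank_riemannRochSpace_add_single_le A P
    rw [Divisor.degree_add, Divisor.degree_single]
    exact ⟨hfin, by omega⟩

end IsFunctionField

theorem linearIndependent_pow_mul {y : F} (hy : Transcendental k y) {ι : Type*} {u : ι → F}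
    (hu : LinearIndependent (IntermediateField.adjoin k {y}) u) :
    LinearIndependent k fun x : ℕ × ι => y ^ x.1 * u x.2 := by
  have hpow : LinearIndependent k fun n : ℕ => IntermediateField.AdjoinSimple.gen k y ^ n := by
    refine .of_comp (IntermediateField.adjoin k {y}).val.toLinearMap ?_
    have hmonomial := (basisMonomials k).linearIndependent.map' (aeval y).toLinearMap
      (LinearMap.ker_eq_bot.2 (transcendental_iff_injective.1 hy))
    simpa only [Function.comp_def, coe_basisMonomials, AlgHom.toLinearMap_apply, aeval_monomial,
      map_one, one_mul, map_pow, IntermediateField.coe_val,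
      IntermediateField.AdjoinSimple.coe_gen] using hmonomial
  exact linearIndependent_smul hpow hu

theorem IsFunctionField.card_zeros_mul_le (hF : IsFunctionField k F) {D C : Divisor k F}
    (hD : 0 ≤ D) (hC : 0 ≤ C) {g : F} (hg : g ∈ riemannRochSpace D) (hgt : Transcendental k g)
    {ι : Type*} [Fintype ι] {u : ι → F} (huC : ∀ i, u i ∈ riemannRochSpace C)
    (hu : LinearIndependent (IntermediateField.adjoin k {g}) u) (l : ℕ) :
    ((l + 1) * Fintype.card ι : ℤ) ≤ l * D.degree + C.degree + 1 := by
  have hmem (x : Fin (l + 1) × ι) : g ^ (x.1 : ℕ) * u x.2 ∈ riemannRochSpace (l • D + C) :=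
    mul_mem_riemannRochSpace (riemannRochSpace_mono
      (nsmul_le_nsmul_left hD (Nat.lt_succ_iff.1 x.1.2)) (pow_mem_riemannRochSpace hg _)) (huC _)
  have hli : LinearIndependent k fun x => (⟨_, hmem x⟩ : riemannRochSpace (l • D + C)) :=
    .of_comp (riemannRochSpace (l • D + C)).subtype <| (linearIndependent_pow_mul hgt hu).comp
      (Prod.map (Fin.val : Fin (l + 1) → ℕ) id) (Fin.val_injective.prodMap Function.injective_id)
  obtain ⟨_, hrank⟩ := hF.finrank_riemannRochSpace_le (add_nonneg (nsmul_nonneg hD l) hC)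
  have hcard := hli.fintype_card_le_finrank
  rw [Fintype.card_prod, Fintype.card_fin] at hcard
  rw [Divisor.degree_add, Divisor.degree_nsmul] at hrank
  exact le_trans (by exact_mod_cast hcard) hrank

theorem IsFunctionField.card_zeros_le_degree (hF : IsFunctionField k F) {D : Divisor k F}
    (hD : 0 ≤ D) {g : F} (hg : g ∈ riemannRochSpace D) (hg0 : g ≠ 0) {S : Finset (Place k F)}
    (hS : ∀ P ∈ S, P.val g < 1) : (S.card : ℤ) ≤ D.degree := by
  rcases S.eq_empty_or_nonempty with rfl | ⟨P, hP⟩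
  · simpa using Divisor.degree_nonneg hD
  have hgt := Valuation.transcendental_of_ne_one k g hg0 (hS P hP).ne
  obtain ⟨u, hu⟩ := exists_linearIndependent_of_zeros hgt S hS
  obtain ⟨C, hC, huC⟩ := hF.exists_forall_mem_riemannRochSpace u
  have hbound := hF.card_zeros_mul_le hD hC hg hgt huC hu (C.degree.toNat + 1)
  rw [Fintype.card_coe, Nat.cast_succ, Int.toNat_of_nonneg (Divisor.degree_nonneg hC)] at hbound
  by_contra! hlt
  nlinarith [Divisor.degree_nonneg hC, Divisor.degree_nonneg hD]

/-! ### Places of subfields -/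

namespace Place

theorem isDiscreteValuationRing_comap {K : Type*} [Field K] (φ : K →+* F) (P : Place k F)
    (h : ∃ x, φ x ∉ P.ring) : IsDiscreteValuationRing (P.ring.comap φ) := by
  obtain ⟨x, hx⟩ := h
  have hx1 : 1 < P.val.comap φ x := by rwa [← not_le, Valuation.comap_apply, P.val_le_one_iff]
  have hring : (P.val.comap φ).valuationSubring = P.ring.comap φ := by
    ext y
    exact P.val_le_one_iff (φ y)
  exact hring ▸ isDiscreteValuationRing_of_isCyclic _ hx1

theorem exists_notMem_ring (P : Place k F) : ∃ z, z ∉ P.ring := by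
  obtain ⟨z, hz⟩ := P.exists_val_eq 1
  refine ⟨z, ?_⟩
  rw [← P.val_le_one_iff, hz, ← WithZero.exp_zero, WithZero.exp_le_exp]
  norm_num

section LiesOver

variable {K : IntermediateField k F}

theorem exists_algebraMap_notMem_ring (K : IntermediateField k F) [Algebra.IsAlgebraic K F]
    (P : Place k F) : ∃ x : K, algebraMap K F x ∉ P.ring := by
  by_contra! h
  have := Valuation.IsTrivialOn.of_le_one P.val fun x : K => (P.val_le_one_iff _).2 (h x)
  obtain ⟨z, hz⟩ := P.exists_notMem_ring
  have hz0 : z ≠ 0 := fun h0 => hz (h0 ▸ P.ring.zero_mem)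
  refine Valuation.transcendental_of_ne_one (v := P.val) K z hz0 (fun hz1 => hz ?_)
    (Algebra.IsAlgebraic.isAlgebraic z)
  exact (P.val_le_one_iff z).1 hz1.le

/-- The place `P ∩ K` of the subfield `K` lying under the place `P` of `F`. -/
def restrict (K : IntermediateField k F) [Algebra.IsAlgebraic K F] (P : Place k F) : Place k K where
  ring := P.ring.comap (algebraMap K F)
  const_mem := P.const_mem
  discrete := P.isDiscreteValuationRing_comap _ (P.exists_algebraMap_notMem_ring K)

theorem liesOver_restrict (K : IntermediateField k F) [Algebra.IsAlgebraic K F] (P : Place k F) :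
    P.LiesOver (P.restrict K) := rfl

namespace LiesOver

variable {P : Place k F} {Q : Place k K}

theorem eq {Q' : Place k K} (h : P.LiesOver Q) (h' : P.LiesOver Q') : Q = Q' :=
  Place.ext (h.trans h'.symm)

theorem isEquiv (h : P.LiesOver Q) : Q.val.IsEquiv (P.val.comap (algebraMap K F)) :=
  Valuation.isEquiv_of_val_le_one fun {x} => by
    rw [Place.val_le_one_iff, Valuation.comap_apply, Place.val_le_one_iff, h]
    rfl

theorem val_le_one_iff (h : P.LiesOver Q) (x : K) : P.val (x : F) ≤ 1 ↔ Q.val x ≤ 1 :=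
  h.isEquiv.le_one_iff_le_one.symm

theorem val_lt_one_iff (h : P.LiesOver Q) (x : K) : P.val (x : F) < 1 ↔ Q.val x < 1 :=
  h.isEquiv.lt_one_iff_lt_one.symm

theorem exists_ord_eq (h : P.LiesOver Q) : ∃ e : ℕ, ∀ x : K, P.ord x = e * Q.ord x := by
  obtain ⟨π, hπ⟩ := Q.exists_val_eq (-1)
  have hπ0 : (π : F) ≠ 0 := by
    rintro h0
    rw [ZeroMemClass.coe_eq_zero.1 h0, map_zero] at hπ
    exact WithZero.exp_ne_zero hπ.symm
  have hπ1 : P.val (π : F) ≤ 1 := by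
    rw [h.val_le_one_iff, hπ, ← WithZero.exp_zero, WithZero.exp_le_exp]
    norm_num
  have hord : 0 ≤ P.ord (π : F) := by
    rwa [← neg_zero, P.neg_le_ord_iff hπ0, WithZero.exp_zero]
  refine ⟨(P.ord (π : F)).toNat, fun x => ?_⟩
  rw [Int.toNat_of_nonneg hord]
  rcases eq_or_ne x 0 with rfl | hx
  · simp [ord]
  have hx0 : Q.val x ≠ 0 := (Q.val.ne_zero_iff).2 hx
  have hQ : Q.val (x / π ^ Q.ord x) = 1 := by
    rw [map_div₀, map_zpow₀, hπ, ord, ← WithZero.exp_zsmul, smul_neg, smul_eq_mul, mul_one,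
      neg_neg, WithZero.exp_log hx0, div_self hx0]
  have hP : P.val (x : F) / P.val (π : F) ^ Q.ord x = 1 := by
    have hP := h.isEquiv.eq_one_iff_eq_one.1 hQ
    rwa [Valuation.comap_apply, map_div₀, map_zpow₀, map_div₀, map_zpow₀] at hP
  rw [ord, eq_of_div_eq_one hP, WithZero.log_zpow, smul_eq_mul, ord, ord]
  ring

theorem ord_eq (h : P.LiesOver Q) (x : K) : P.ord x = P.ramificationIndex Q * Q.ord x :=
  Nat.sInf_mem (s := {e : ℕ | ∀ x : K, P.ord (x : F) = e * Q.ord x}) h.exists_ord_eq x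

theorem conormCoeff_eq (h : P.LiesOver Q) (A : Divisor k K) :
    Divisor.conormCoeff A P = P.ramificationIndex Q * A Q := by
  classical
  rw [Divisor.conormCoeff, Finsupp.sum_eq_single Q (fun Q' _ hQ' => if_neg fun h' => hQ' (h'.eq h))
    (by simp), if_pos h]

end LiesOver

variable [Algebra.IsAlgebraic K F] {A : Divisor k K}

theorem conormCoeff_nonneg (hA : 0 ≤ A) (P : Place k F) : 0 ≤ Divisor.conormCoeff A P := by
  rw [(P.liesOver_restrict K).conormCoeff_eq]
  exact mul_nonneg (Nat.cast_nonneg _) (hA _)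

theorem val_le_exp_conormCoeff {x : K} (hx : x ∈ riemannRochSpace A) (P : Place k F) :
    P.val (x : F) ≤ WithZero.exp (Divisor.conormCoeff A P) := by
  rcases eq_or_ne x 0 with rfl | hx0
  · simp
  have hxF : (x : F) ≠ 0 := ZeroMemClass.coe_eq_zero.not.2 hx0
  have h := P.liesOver_restrict K
  rw [← P.neg_le_ord_iff hxF, h.ord_eq, h.conormCoeff_eq, ← mul_neg]
  refine mul_le_mul_of_nonneg_left ?_ (Nat.cast_nonneg _)
  rw [neg_le_ord_iff _ hx0]
  exact mem_riemannRochSpace_iff.1 hx _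

end LiesOver

/-! ### The action of automorphisms on places -/

section Action

open scoped Pointwise

/-- The place `σ(P)`, with valuation ring `σ(O_P)`. -/
instance : SMul (F ≃ₐ[k] F) (Place k F) where
  smul σ P :=
    { ring := σ • P.ring
      const_mem := fun a => by
        rw [ValuationSubring.mem_pointwise_smul_iff_inv_smul_mem, AlgEquiv.smul_def,
          AlgEquiv.commutes]
        exact P.const_mem a
      discrete := by
        have hring : P.ring.comap ((σ⁻¹ : F ≃ₐ[k] F) : F →+* F) = σ • P.ring := by
          ext z
          exact (ValuationSubring.mem_pointwise_smul_iff_inv_smul_mem (g := σ)).symm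
        obtain ⟨z, hz⟩ := P.exists_notMem_ring
        exact hring ▸ P.isDiscreteValuationRing_comap _ ⟨σ z, by simpa using hz⟩ }

instance : MulAction (F ≃ₐ[k] F) (Place k F) :=
  Function.Injective.mulAction ring (fun _ _ => Place.ext) fun _ _ => rfl

theorem isEquiv_smul (σ : F ≃ₐ[k] F) (P : Place k F) :
    (σ • P).val.IsEquiv (P.val.comap ((σ⁻¹ : F ≃ₐ[k] F) : F →+* F)) :=
  Valuation.isEquiv_of_val_le_one fun {z} => by
    rw [val_le_one_iff, Valuation.comap_apply, val_le_one_iff]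
    exact ValuationSubring.mem_pointwise_smul_iff_inv_smul_mem (g := σ)

theorem val_smul_le_one_iff (σ : F ≃ₐ[k] F) (P : Place k F) (z : F) :
    (σ • P).val z ≤ 1 ↔ P.val (σ⁻¹ z) ≤ 1 :=
  (isEquiv_smul σ P).le_one_iff_le_one

theorem val_smul_lt_one_iff (σ : F ≃ₐ[k] F) (P : Place k F) (z : F) :
    (σ • P).val z < 1 ↔ P.val (σ⁻¹ z) < 1 :=
  (isEquiv_smul σ P).lt_one_iff_lt_one

theorem orbit_eq (H : Subgroup (F ≃ₐ[k] F)) (P : Place k F) : orbit H P = MulAction.orbit H P := by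
  ext P'
  refine ⟨?_, ?_⟩
  · rintro ⟨σ, hσ, h⟩
    refine ⟨⟨σ, hσ⟩, Place.ext ?_⟩
    ext z
    rw [← σ.apply_symm_apply z, h]
    exact ValuationSubring.smul_mem_pointwise_smul_iff (g := σ)
  · rintro ⟨σ, rfl⟩
    exact ⟨σ, σ.2, fun z => ValuationSubring.smul_mem_pointwise_smul_iff (g := σ.1)⟩

theorem LiesOver.smul {G : Subgroup (F ≃ₐ[k] F)} {P : Place k F}
    {Q : Place k (IntermediateField.fixedField G)} (h : P.LiesOver Q) (σ : G) :
    (σ • P).LiesOver Q := by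
  refine h.trans ?_
  ext x
  have hx : σ.1⁻¹ (x : F) = x := (IntermediateField.mem_fixedField_iff G _).1 x.2 _ (inv_mem σ.2)
  change (x : F) ∈ P.ring ↔ (x : F) ∈ (σ.1 • P).ring
  rw [← Place.val_le_one_iff, ← Place.val_le_one_iff, val_smul_le_one_iff, hx]

end Action

end Place

/-! ### Places over a fixed field -/

section FixedField

variable (G : Subgroup (F ≃ₐ[k] F))

theorem prod_smul_mem_fixedField [Fintype G] (z : F) :
    ∏ σ : G, σ • z ∈ IntermediateField.fixedField G :=
  (IntermediateField.mem_fixedField_iff G _).2 fun τ hτ => by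
    rw [map_prod]
    exact Fintype.prod_bijective _ (Group.mulLeft_bijective (⟨τ, hτ⟩ : G)) _ _ fun σ =>
      smul_smul (⟨τ, hτ⟩ : G) σ z

theorem sum_smul_mem_fixedField [Fintype G] (z : F) :
    ∑ σ : G, σ • z ∈ IntermediateField.fixedField G :=
  (IntermediateField.mem_fixedField_iff G _).2 fun τ hτ => by
    rw [map_sum]
    exact Fintype.sum_bijective _ (Group.mulLeft_bijective (⟨τ, hτ⟩ : G)) _ _ fun σ =>
      smul_smul (⟨τ, hτ⟩ : G) σ z

theorem finrank_fixedField [Finite G] :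
    Module.finrank (IntermediateField.fixedField G) F = Nat.card G := by
  have := Fintype.ofFinite G
  rw [Nat.card_eq_fintype_card]
  exact FixedPoints.finrank_eq_card G F

instance finiteDimensional_fixedField [Finite G] :
    FiniteDimensional (IntermediateField.fixedField G) F :=
  inferInstanceAs (FiniteDimensional (FixedPoints.subfield G F) F)

theorem finite_of_finiteDimensional_fixedField
    [FiniteDimensional (IntermediateField.fixedField G) F] : Finite G :=
  have hle : G ≤ (IntermediateField.fixedField G).fixingSubgroup :=
    (IntermediateField.le_iff_le G _).1 le_rfl
  have : Finite (IntermediateField.fixedField G).fixingSubgroup :=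
    .of_equiv _ (IntermediateField.fixingSubgroupEquiv _).symm.toEquiv
  .of_injective _ (Subgroup.inclusion_injective hle)

end FixedField

namespace Place

variable {G : Subgroup (F ≃ₐ[k] F)} {P P' : Place k F}
  {Q : Place k (IntermediateField.fixedField G)}

theorem LiesOver.exists_smul_eq [Finite G] (h : P.LiesOver Q) (h' : P'.LiesOver Q) :
    ∃ σ : G, σ • P = P' := by
  classical
  have := Fintype.ofFinite G
  by_contra! hne
  let S : Finset (Place k F) := Finset.univ.image (fun σ : G => σ • P) ∪
    Finset.univ.image fun σ : G => σ • P'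
  obtain ⟨z, hz, hzS⟩ := P'.exists_val_sub_lt_one S (map_one _).le
  have hzP (σ : G) : (σ • P).val z < 1 := hzS _ (by simp [S]) (hne σ)
  have hzP' (σ : G) : (σ • P').val (1 - z) ≤ 1 := by
    by_cases hσ : σ • P' = P'
    · rw [hσ, Valuation.map_sub_swap]
      exact hz.le
    · exact (Valuation.map_one_sub_of_lt _ (hzS _ (by simp [S]) hσ)).le
  let N : IntermediateField.fixedField G := ⟨_, prod_smul_mem_fixedField G (1 - z)⟩
  have hNP : P.val (N : F) = 1 := by
    rw [map_prod]
    refine Finset.prod_eq_one fun σ _ => (isEquiv_smul σ.1⁻¹ P).eq_one_iff_eq_one.1 ?_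
    exact Valuation.map_one_sub_of_lt _ (hzP σ⁻¹)
  have hNP' : P'.val (N : F) < 1 := by
    rw [map_prod, ← Finset.mul_prod_erase _ _ (Finset.mem_univ (1 : G)), one_smul]
    refine mul_lt_one_of_lt_of_le (by rwa [Valuation.map_sub_swap]) (Finset.prod_le_one' ?_)
    exact fun σ _ => (isEquiv_smul σ.1⁻¹ P').le_one_iff_le_one.1 (hzP' σ⁻¹)
  exact hNP.not_lt ((h.val_lt_one_iff N).2 ((h'.val_lt_one_iff N).1 hNP'))

theorem LiesOver.setOf_eq_orbit [Finite G] (h : P.LiesOver Q) :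
    {P' : Place k F | P'.LiesOver Q} = MulAction.orbit G P :=
  Set.Subset.antisymm (fun _ h' => h.exists_smul_eq h') <| by
    rintro _ ⟨σ, rfl⟩
    exact h.smul σ

theorem SplitsCompletely.finite (hQ : Q.SplitsCompletely) : Finite G :=
  have := hQ.1
  finite_of_finiteDimensional_fixedField G

theorem SplitsCompletely.ncard_eq (hQ : Q.SplitsCompletely) :
    {P : Place k F | P.LiesOver Q}.ncard = Nat.card G :=
  have := hQ.finite
  hQ.2.trans (finrank_fixedField G)

theorem SplitsCompletely.stabilizer_eq_bot (hQ : Q.SplitsCompletely) (h : P.LiesOver Q) :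
    MulAction.stabilizer G P = ⊥ := by
  have := hQ.finite
  have hindex : (MulAction.stabilizer G P).index = Nat.card G := by
    rw [MulAction.index_stabilizer, ← h.setOf_eq_orbit, hQ.ncard_eq]
  have hcard := (MulAction.stabilizer G P).card_mul_index
  rw [hindex] at hcard
  exact Subgroup.card_eq_one.1 (Nat.eq_of_mul_eq_mul_right Nat.card_pos (by rw [hcard, one_mul]))

theorem SplitsCompletely.eq_one_of_smul_eq (hQ : Q.SplitsCompletely) (h : P.LiesOver Q)
    {σ : F ≃ₐ[k] F} (hσ : σ ∈ G) (hP : σ • P = P) : σ = 1 := by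
  have hmem : (⟨σ, hσ⟩ : G) ∈ MulAction.stabilizer G P := hP
  rw [hQ.stabilizer_eq_bot h, Subgroup.mem_bot] at hmem
  exact congrArg Subtype.val hmem

theorem isRational_iff (P : Place k F) :
    P.IsRational ↔ ∀ z, P.val z ≤ 1 → ∃ a : k, P.val (z - algebraMap k F a) < 1 := by
  have key (z : P.ring) (a : k) : a • (1 : IsLocalRing.ResidueField P.ring) =
      IsLocalRing.residue P.ring z ↔ P.val ((z : F) - algebraMap k F a) < 1 := by
    rw [eq_comm, ← sub_eq_zero, Algebra.smul_def, mul_one,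
      show algebraMap k (IsLocalRing.ResidueField P.ring) a =
        IsLocalRing.residue P.ring (algebraMap k P.ring a) from rfl, ← map_sub,
      P.residue_eq_zero_iff]
    rfl
  rw [IsRational, degree, finrank_eq_one_iff_of_nonzero' _ one_ne_zero]
  refine ⟨fun h z hz => ?_, fun h w => ?_⟩
  · obtain ⟨a, ha⟩ := h (IsLocalRing.residue P.ring ⟨z, (P.val_le_one_iff z).1 hz⟩)
    exact ⟨a, (key _ _).1 ha⟩
  · obtain ⟨z, rfl⟩ := IsLocalRing.residue_surjective w
    obtain ⟨a, ha⟩ := h z ((P.val_le_one_iff _).2 z.2)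
    exact ⟨a, (key _ _).2 ha⟩

theorem SplitsCompletely.isRational (hQ : Q.SplitsCompletely) (hQrat : Q.IsRational)
    (h : P.LiesOver Q) : P.IsRational := by
  classical
  have := hQ.finite
  have := Fintype.ofFinite G
  refine P.isRational_iff.2 fun z hz => ?_
  obtain ⟨z', hz', hz'S⟩ := P.exists_val_sub_lt_one (Finset.univ.image fun σ : G => σ • P) hz
  have hconj (σ : G) (hσ : σ ≠ 1) : P.val (σ • z') < 1 := by
    refine (val_smul_lt_one_iff σ.1⁻¹ P z').1 (hz'S (σ⁻¹ • P) (by simp) fun hP => hσ ?_)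
    exact Subtype.ext (inv_eq_one.1 (hQ.eq_one_of_smul_eq h (G.inv_mem σ.2) hP))
  -- Only the summand `σ = 1` of the trace survives modulo `P`.
  let T : IntermediateField.fixedField G := ⟨_, sum_smul_mem_fixedField G z'⟩
  have hT : P.val ((T : F) - z) < 1 := by
    have hsplit : ∑ σ : G, σ • z' - z = (z' - z) + ∑ σ ∈ Finset.univ.erase (1 : G), σ • z' := by
      rw [← Finset.add_sum_erase _ _ (Finset.mem_univ (1 : G)), one_smul]
      ring
    change P.val (∑ σ : G, σ • z' - z) < 1
    rw [hsplit]
    exact P.val.map_add_lt hz' (P.val.map_sum_lt one_ne_zero fun σ hσ =>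
      hconj σ (Finset.ne_of_mem_erase hσ))
  have hT1 : P.val (T : F) ≤ 1 := by
    simpa using P.val.map_add_le hT.le hz
  obtain ⟨a, ha⟩ := Q.isRational_iff.1 hQrat T ((h.val_le_one_iff T).1 hT1)
  refine ⟨a, ?_⟩
  rw [← sub_sub_sub_cancel_left _ _ (T : F)]
  refine P.val.map_sub_lt ((h.val_lt_one_iff _).2 ha) hT

end Place

/-! ### Values of functions at places -/

namespace Place

theorem hasValue_iff (P : Place k F) (z : F) (a : k) :
    P.HasValue z a ↔ P.val (z - algebraMap k F a) < 1 :=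
  (P.val_lt_one_iff _).symm

theorem hasValue_zero_iff (P : Place k F) (z : F) : P.HasValue z 0 ↔ P.val z < 1 := by
  rw [hasValue_iff, map_zero, sub_zero]

theorem HasValue.val_le_one {P : Place k F} {z : F} {a : k} (h : P.HasValue z a) :
    P.val z ≤ 1 := by
  simpa using P.val.map_add_le ((P.hasValue_iff _ _).1 h).le
    (Valuation.IsTrivialOn.valuation_algebraMap_le_one P.val a)

/-- The graph of evaluation at `P`: the pairs `(z, a)` such that `z` has the value `a` at `P`.
That it is a subalgebra of `F × k` says that taking values is compatible with the operations. -/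
def valueGraph (P : Place k F) : Subalgebra k (F × k) where
  carrier := {p | P.HasValue p.1 p.2}
  algebraMap_mem' a := by simp [hasValue_iff]
  add_mem' {p q} hp hq := by
    have h := P.val.map_add_lt ((P.hasValue_iff _ _).1 hp) ((P.hasValue_iff _ _).1 hq)
    rw [sub_add_sub_comm, ← map_add] at h
    exact (P.hasValue_iff _ _).2 h
  mul_mem' {p q} hp hq := by
    refine (P.hasValue_iff _ _).2 ?_
    rw [show (p * q).1 - algebraMap k F (p * q).2 = (p.1 - algebraMap k F p.2) * q.1 +
      algebraMap k F p.2 * (q.1 - algebraMap k F q.2) by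
        rw [Prod.fst_mul, Prod.snd_mul, map_mul]; ring]
    refine P.val.map_add_lt ?_ ?_ <;> rw [map_mul]
    · exact mul_lt_one_of_lt_of_le ((P.hasValue_iff _ _).1 hp) hq.val_le_one
    · exact (mul_le_of_le_one_left' (Valuation.IsTrivialOn.valuation_algebraMap_le_one P.val _))
        |>.trans_lt ((P.hasValue_iff _ _).1 hq)

theorem mk_mem_valueGraph {P : Place k F} {z : F} {a : k} :
    (z, a) ∈ P.valueGraph ↔ P.HasValue z a :=
  Iff.rfl

theorem HasValue.sum_mul_pow {P : Place k F} {ι : Type*} {s : Finset ι} {x : ι → F} {a : ι → k}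
    (hx : ∀ i ∈ s, P.HasValue (x i) (a i)) {w : F} {b : k} (hw : P.HasValue w b) (e : ι → ℕ) :
    P.HasValue (∑ i ∈ s, x i * w ^ e i) (∑ i ∈ s, a i * b ^ e i) := by
  have h := P.valueGraph.sum_mem fun i hi => P.valueGraph.mul_mem
    (mk_mem_valueGraph.2 (hx i hi)) (P.valueGraph.pow_mem (mk_mem_valueGraph.2 hw) (e i))
  change P.HasValue (Prod.fst _) (Prod.snd _) at h
  rwa [Prod.fst_sum, Prod.snd_sum] at h

theorem HasValue.unique {P : Place k F} {z : F} {a b : k} (ha : P.HasValue z a)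
    (hb : P.HasValue z b) : a = b := by
  have h := P.valueGraph.sub_mem (mk_mem_valueGraph.2 ha) (mk_mem_valueGraph.2 hb)
  rw [Prod.mk_sub_mk, mk_mem_valueGraph, hasValue_iff, sub_self, zero_sub, Valuation.map_neg,
    val_algebraMap_lt_one_iff] at h
  exact sub_eq_zero.1 h

theorem HasValue.hasValue_value {P : Place k F} {z : F} {a : k} (ha : P.HasValue z a) :
    P.HasValue z (P.value z) := by
  have h : ∃ a, P.HasValue z a := ⟨a, ha⟩
  rw [value, dif_pos h]
  exact h.choose_spec

theorem HasValue.value_eq {P : Place k F} {z : F} {a : k} (ha : P.HasValue z a) :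
    P.value z = a :=
  ha.hasValue_value.unique ha

theorem HasValue.extValue_eq {P : Place k F} {z : F} {a : k} (ha : P.HasValue z a) :
    P.extValue z = (a : OnePoint k) := by
  rw [extValue, if_pos ((P.val_le_one_iff _).1 ha.val_le_one), ha.value_eq]

theorem IsRational.hasValue_value {P : Place k F} (hP : P.IsRational) {z : F}
    (hz : P.val z ≤ 1) : P.HasValue z (P.value z) := by
  obtain ⟨a, ha⟩ := P.isRational_iff.1 hP z hz
  exact ((P.hasValue_iff _ _).2 ha).hasValue_value

theorem HasValue.of_mem_orbit {H : Subgroup (F ≃ₐ[k] F)} {P : Place k F}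
    {x : IntermediateField.fixedField H} {a : k} (h : P.HasValue x a) {P' : Place k F}
    (hP' : P' ∈ orbit H P) : P'.HasValue x a := by
  rw [orbit_eq] at hP'
  obtain ⟨σ, rfl⟩ := hP'
  have hx : σ.1⁻¹ (x : F) = x := (IntermediateField.mem_fixedField_iff H _).1 x.2 _ (inv_mem σ.2)
  refine (hasValue_iff _ _ _).2 ((val_smul_lt_one_iff σ.1 P _).2 ?_)
  rw [map_sub, hx, AlgEquiv.commutes]
  exact (P.hasValue_iff _ _).1 h

theorem val_le_exp_poleOrder (P : Place k F) (z : F) : P.val z ≤ WithZero.exp (P.poleOrder z) := by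
  rcases eq_or_ne z 0 with rfl | hz
  · simp
  · rw [← P.neg_le_ord_iff hz, poleOrder, neg_le]
    exact le_max_right 0 _

theorem poleOrder_nonneg (P : Place k F) (z : F) : 0 ≤ P.poleOrder z := le_max_left _ _

end Place

/-! ### The function spaces -/

section FunctionSpace

variable {K : IntermediateField k F} {A : Divisor k K} {m : ℕ} {f : Fin m → riemannRochSpace A}
  {w : F} {r : ℕ} {D : Divisor k F}

theorem exists_coeff_of_mem_functionSpace {z : F}
    (hz : z ∈ functionSpace (k := k) (fun j => ((f j : K) : F)) w r) :
    ∃ a : Fin r → K, (∀ l, a l ∈ riemannRochSpace A) ∧ z = ∑ l, (a l : F) * w ^ (l : ℕ) := by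
  obtain ⟨c, rfl⟩ := hz
  refine ⟨fun l => ((∑ j, c j l • f j : riemannRochSpace A) : K), fun l => SetLike.coe_mem _, ?_⟩
  refine Finset.sum_congr rfl fun l _ => congrArg (· * w ^ (l : ℕ)) ?_
  simp only [AddSubmonoidClass.coe_finsetSum, SetLike.val_smul]

variable [Algebra.IsAlgebraic K F]

theorem functionSpace_le_riemannRochSpace
    (hD : ∀ P : Place k F, ((r : ℤ) - 1) * P.poleOrder w + Divisor.conormCoeff A P ≤ D P) :
    functionSpace (fun j => ((f j : K) : F)) w r ≤ riemannRochSpace D := by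
  intro z hz
  obtain ⟨a, ha, rfl⟩ := exists_coeff_of_mem_functionSpace hz
  refine Submodule.sum_mem _ fun l _ => mem_riemannRochSpace_iff.2 fun P => ?_
  have hl : ((l : ℕ) : ℤ) ≤ (r : ℤ) - 1 := by omega
  calc P.val ((a l : F) * w ^ (l : ℕ))
      = P.val (a l : F) * P.val w ^ (l : ℕ) := by rw [map_mul, map_pow]
    _ ≤ WithZero.exp (Divisor.conormCoeff A P) * WithZero.exp (P.poleOrder w) ^ (l : ℕ) :=
        mul_le_mul' (P.val_le_exp_conormCoeff (ha l))
          (pow_le_pow_left₀ zero_le (P.val_le_exp_poleOrder w) _)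
    _ = WithZero.exp (Divisor.conormCoeff A P + (l : ℕ) * P.poleOrder w) := by
        rw [← WithZero.exp_nsmul, ← WithZero.exp_add, nsmul_eq_mul]
    _ ≤ WithZero.exp (D P) := WithZero.exp_le_exp.2 <| by
        linarith [hD P, mul_le_mul_of_nonneg_right hl (P.poleOrder_nonneg w)]

namespace Place

variable {P : Place k F}

theorem val_le_one_of_mem_riemannRochSpace (hr : 1 ≤ r)
    (hP : ((r : ℤ) - 1) * P.poleOrder w + Divisor.conormCoeff A P ≤ 0) {x : K}
    (hx : x ∈ riemannRochSpace A) : P.val (x : F) ≤ 1 := by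
  have hw : 0 ≤ ((r : ℤ) - 1) * P.poleOrder w := mul_nonneg (by omega) (P.poleOrder_nonneg w)
  refine (P.val_le_exp_conormCoeff hx).trans ?_
  rw [← WithZero.exp_zero, WithZero.exp_le_exp]
  linarith

theorem val_le_one_of_two_le (hr : 2 ≤ r) (hA : 0 ≤ A)
    (hP : ((r : ℤ) - 1) * P.poleOrder w + Divisor.conormCoeff A P ≤ 0) : P.val w ≤ 1 := by
  have hw : P.poleOrder w ≤ ((r : ℤ) - 1) * P.poleOrder w :=
    le_mul_of_one_le_left (P.poleOrder_nonneg w) (by omega)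
  refine (P.val_le_exp_poleOrder w).trans ?_
  rw [← WithZero.exp_zero, WithZero.exp_le_exp]
  linarith [conormCoeff_nonneg hA P]

end Place

end FunctionSpace

/-! ### Local recovery -/

namespace Place

theorem hasValue_zero_of_forall_mem {r : ℕ} {a : Fin r → F} {w : F} {α : Fin r → k}
    {P : Place k F} {S : Finset (Place k F)} (hr : r ≤ S.card)
    (ha : ∀ l, P.HasValue (a l) (α l)) (haS : ∀ P' ∈ S, ∀ l, P'.HasValue (a l) (α l))
    (hw : ∃ b, P.HasValue w b) (hwS : ∀ P' ∈ S, ∃ b, P'.HasValue w b)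
    (hinj : Set.InjOn (fun P' : Place k F => P'.extValue w) S)
    (hS : ∀ P' ∈ S, P'.HasValue (∑ l, a l * w ^ (l : ℕ)) 0) :
    P.HasValue (∑ l, a l * w ^ (l : ℕ)) 0 := by
  obtain ⟨b, hb⟩ := hw
  have hb' (P') (hP' : P' ∈ S) : P'.HasValue w (P'.value w) :=
    (hwS P' hP').choose_spec.hasValue_value
  have hvalue : Set.InjOn (fun P' : Place k F => P'.value w) S := fun P₁ h₁ P₂ h₂ h =>
    hinj h₁ h₂ <| by
      simpa only [(hb' P₁ h₁).extValue_eq, (hb' P₂ h₂).extValue_eq] using congrArg _ h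
  -- All values of `∑ a_l w^l` are values of one polynomial of degree less than `r`.
  have heval (x : k) : (∑ l : Fin r, C (α l) * X ^ (l : ℕ)).eval x = ∑ l, α l * x ^ (l : ℕ) := by
    simp only [eval_finsetSum, eval_mul, eval_C, eval_pow, eval_X]
  have hzero : ∑ l : Fin r, C (α l) * X ^ (l : ℕ) = 0 := by
    refine eq_zero_of_degree_lt_of_eval_index_eq_zero _ hvalue
      ((degree_sum_fin_lt α).trans_le (by exact_mod_cast hr)) fun P' hP' => ?_
    rw [heval]
    exact (HasValue.sum_mul_pow (fun l _ => haS P' hP' l) (hb' P' hP') _).unique (hS P' hP')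
  have h := HasValue.sum_mul_pow (s := Finset.univ) (fun l _ => ha l) hb fun l : Fin r => (l : ℕ)
  rwa [← heval, hzero, eval_zero] at h

theorem hasValue_zero_of_mem_functionSpace {H : Subgroup (F ≃ₐ[k] F)} [Finite H] {r : ℕ}
    (hr : 1 ≤ r) {A : Divisor k (IntermediateField.fixedField H)} (hA : 0 ≤ A) {w : F} {m : ℕ}
    {f : Fin m → riemannRochSpace A} {P : Place k F} (hP : r + 1 ≤ (orbit H P).ncard)
    (hrat : ∀ P' ∈ orbit H P, P'.IsRational)
    (hpole : ∀ P' ∈ orbit H P, ((r : ℤ) - 1) * P'.poleOrder w + Divisor.conormCoeff A P' ≤ 0)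
    (hw : Set.InjOn (fun P' : Place k F => P'.extValue w) (orbit H P)) {z : F}
    (hz : z ∈ functionSpace (k := k) (fun j => ((f j : IntermediateField.fixedField H) : F)) w r)
    (hz0 : ∀ P' ∈ orbit H P, P' ≠ P → P'.HasValue z 0) : P.HasValue z 0 := by
  classical
  obtain ⟨a, ha, rfl⟩ := exists_coeff_of_mem_functionSpace hz
  have hfin : (orbit H P).Finite := Set.finite_of_ncard_pos (by omega)
  have hPmem : P ∈ orbit H P := ⟨1, H.one_mem, fun _ => Iff.rfl⟩
  have hcoeff (l) : P.HasValue (a l : F) (P.value (a l)) :=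
    (hrat P hPmem).hasValue_value (val_le_one_of_mem_riemannRochSpace hr (hpole P hPmem) (ha l))
  let S := hfin.toFinset.erase P
  have hS {P' : Place k F} : P' ∈ S ↔ P' ≠ P ∧ P' ∈ orbit H P := by simp [S]
  have hcard : r ≤ S.card := by
    rw [Finset.card_erase_of_mem (hfin.mem_toFinset.2 hPmem), ← Set.ncard_eq_toFinset_card _ hfin]
    omega
  rcases hr.eq_or_lt with rfl | hr2
  · -- Here `w` may have poles in the orbit of `P`, but it does not occur in `∑ a_l w^l = a_0`.
    obtain ⟨P', hP'⟩ := Finset.card_pos.1 hcard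
    have h0 : P.value (a 0 : F) = 0 := by
      refine ((hcoeff 0).of_mem_orbit (hS.1 hP').2).unique ?_
      simpa using hz0 P' (hS.1 hP').2 (hS.1 hP').1
    simpa [h0] using hcoeff 0
  · have hwval (P') (hP' : P' ∈ orbit H P) : ∃ b, P'.HasValue w b :=
      ⟨_, (hrat P' hP').hasValue_value (val_le_one_of_two_le hr2 hA (hpole P' hP'))⟩
    exact hasValue_zero_of_forall_mem hcard hcoeff
      (fun P' hP' l => (hcoeff l).of_mem_orbit (hS.1 hP').2) (hwval P hPmem)
      (fun P' hP' => hwval P' (hS.1 hP').2) (hw.mono fun P' hP' => (hS.1 hP').2)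
      fun P' hP' => hz0 P' (hS.1 hP').2 (hS.1 hP').1

end Place

/-! ### Linear locally repairable codes -/

section LinearCode

variable {n : ℕ} {C : Submodule k (Fin n → k)}

open Classical in
theorem le_minDist (hC : C ≠ ⊥) {d : ℕ}
    (h : ∀ c ∈ C, c ≠ 0 → d ≤ hammingNorm c) : d ≤ minDist (C : Set (Fin n → k)) := by
  obtain ⟨c, hc, hc0⟩ := C.exists_mem_ne_zero_of_ne_bot hC
  refine le_csInf ⟨_, c, hc, 0, C.zero_mem, hc0, rfl⟩ ?_
  rintro _ ⟨x, hx, y, hy, hxy, rfl⟩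
  have hd := h _ (C.add_mem (C.neg_mem hx) hy) (neg_add_eq_zero.not.2 hxy)
  rwa [← hammingDist_eq_hammingNorm] at hd

theorem isLocallyRepairable {t : ℕ} {r : Fin t → ℕ} (I : Fin t → Fin n → Finset (Fin n))
    (hdisj : ∀ j, Pairwise fun i i' => Disjoint (I i j) (I i' j))
    (hmem : ∀ i j, j ∉ I i j) (hcard : ∀ i j, (I i j).card ≤ r i)
    (hC : ∀ i j, ∀ c ∈ C, (∀ l ∈ I i j, c l = 0) → c j = 0) :
    IsLocallyRepairable (C : Set (Fin n → k)) r := by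
  refine fun j => ⟨fun i => I i j, fun i i' hii' => hdisj j hii', fun i =>
    ⟨hmem i j, hcard i j, fun a b hab => Set.disjoint_left.2 ?_⟩⟩
  rintro _ ⟨c, ⟨hc, rfl⟩, rfl⟩ ⟨c', ⟨hc', rfl⟩, hcc'⟩
  refine hab (sub_eq_zero.1 (hC i j _ (C.sub_mem hc hc') fun l hl => sub_eq_zero.2 ?_))
  exact (congrFun hcc' ⟨l, hl⟩).symm

end LinearCode

/-! ### Recovering sets from orbits -/

section Orbit

theorem ncard_orbit {A X : Type*} [Group A] [MulAction A X] {x : X} {H : Subgroup A}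
    (hx : ∀ σ ∈ H, σ • x = x → σ = 1) : (MulAction.orbit H x).ncard = Nat.card H := by
  have hstab : MulAction.stabilizer H x = ⊥ :=
    (Subgroup.eq_bot_iff_forall _).2 fun σ hσ => Subtype.ext (hx σ σ.2 hσ)
  rw [← MulAction.index_stabilizer, hstab, Subgroup.index_bot]

theorem eq_of_mem_orbit_of_mem_orbit {A X : Type*} [Group A] [MulAction A X] {x : X}
    {G H₁ H₂ : Subgroup A} (h₁ : H₁ ≤ G) (h₂ : H₂ ≤ G) (hinf : H₁ ⊓ H₂ = ⊥)
    (hx : ∀ σ ∈ G, σ • x = x → σ = 1) {y : X} (hy₁ : y ∈ MulAction.orbit H₁ x)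
    (hy₂ : y ∈ MulAction.orbit H₂ x) : y = x := by
  obtain ⟨σ, rfl⟩ := hy₁
  obtain ⟨τ, hτ⟩ := hy₂
  have hστ : σ.1 = τ.1 := inv_mul_eq_one.1 <|
    hx (σ.1⁻¹ * τ.1) (G.mul_mem (G.inv_mem (h₁ σ.2)) (h₂ τ.2)) <| by
      rw [mul_smul, inv_smul_eq_iff]
      exact hτ
  have hσ : σ.1 ∈ H₁ ⊓ H₂ := ⟨σ.2, hστ ▸ τ.2⟩
  rw [hinf, Subgroup.mem_bot] at hσ
  change σ.1 • x = x
  rw [hσ, one_smul]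

open Classical in
/-- The coordinates other than `j` whose places lie in the `H`-orbit of the `j`-th place: they
determine the coordinate `j` of a codeword. -/
def recoveringSet {n : ℕ} (P : Fin n → Place k F) (H : Subgroup (F ≃ₐ[k] F)) (j : Fin n) :
    Finset (Fin n) :=
  {j' | j' ≠ j ∧ P j' ∈ Place.orbit H (P j)}

variable {n : ℕ} {P : Fin n → Place k F} {j : Fin n}

theorem mem_recoveringSet {H : Subgroup (F ≃ₐ[k] F)} {j' : Fin n} :
    j' ∈ recoveringSet P H j ↔ j' ≠ j ∧ P j' ∈ Place.orbit H (P j) := by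
  simp only [recoveringSet, Finset.mem_filter_univ]

theorem card_recoveringSet_le (hP : Function.Injective P) {H : Subgroup (F ≃ₐ[k] F)} {r : ℕ}
    (hr : (Place.orbit H (P j)).ncard = r + 1) : (recoveringSet P H j).card ≤ r := by
  rw [← Nat.lt_succ_iff, Nat.succ_eq_add_one, ← hr, ← Set.ncard_coe_finset,
    ← Set.ncard_image_of_injective _ hP]
  refine Set.ncard_lt_ncard ((Set.ssubset_iff_of_subset ?_).2 ⟨P j, ?_, ?_⟩)
    (Set.finite_of_ncard_pos (hr ▸ r.succ_pos))
  · rintro _ ⟨j', hj', rfl⟩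
    exact (mem_recoveringSet.1 hj').2
  · exact ⟨1, H.one_mem, fun _ => Iff.rfl⟩
  · rintro ⟨j', hj', hjj'⟩
    exact (mem_recoveringSet.1 hj').1 (hP hjj')

theorem disjoint_recoveringSet (hP : Function.Injective P) {G H₁ H₂ : Subgroup (F ≃ₐ[k] F)}
    (h₁ : H₁ ≤ G) (h₂ : H₂ ≤ G) (hinf : H₁ ⊓ H₂ = ⊥)
    (hPj : ∀ σ ∈ G, σ • P j = P j → σ = 1) :
    Disjoint (recoveringSet P H₁ j) (recoveringSet P H₂ j) := by
  refine Finset.disjoint_left.2 fun j' hj₁ hj₂ => (mem_recoveringSet.1 hj₁).1 (hP ?_)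
  rw [mem_recoveringSet, Place.orbit_eq] at hj₁ hj₂
  exact eq_of_mem_orbit_of_mem_orbit h₁ h₂ hinf hPj hj₁.2 hj₂.2

end Orbit

/-! ### The code -/

theorem IsSemidirectProduct.card_eq {A : Type*} [Group A] {G H₁ H₂ : Subgroup A}
    (h : IsSemidirectProduct G H₁ H₂) : Nat.card G = Nat.card H₁ * Nat.card H₂ := by
  let φ : H₁ × H₂ → G := fun p => ⟨p.1 * p.2, G.mul_mem (h.le_left p.1.2) (h.le_right p.2.2)⟩
  have hinj : Function.Injective φ := fun _ _ hpq =>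
    Subgroup.mul_injective_of_disjoint (disjoint_iff.2 h.inf_eq) (congrArg Subtype.val hpq)
  have hsurj : Function.Surjective φ := by
    rintro ⟨g, hg⟩
    obtain ⟨h₁, hh₁, h₂, hh₂, rfl⟩ := h.exists_mul g hg
    exact ⟨(⟨h₁, hh₁⟩, ⟨h₂, hh₂⟩), rfl⟩
  rw [← Nat.card_prod, Nat.card_congr (Equiv.ofBijective φ ⟨hinj, hsurj⟩)]

section Code

variable {n : ℕ} {P : Fin n → Place k F}

theorem card_eq_mul_card_of_splitsCompletely {G : Subgroup (F ≃ₐ[k] F)} {s : ℕ}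
    {Q : Fin s → Place k (IntermediateField.fixedField G)} (hQ : Function.Injective Q)
    (hQsplit : ∀ i, (Q i).SplitsCompletely) (hP : Function.Injective P)
    (hPQ : Set.range P = {P' | ∃ i, P'.LiesOver (Q i)}) : n = s * Nat.card G := by
  have hfin (i) : {P' : Place k F | P'.LiesOver (Q i)}.Finite := by
    have := (hQsplit i).finite
    exact Set.finite_of_ncard_pos ((hQsplit i).ncard_eq ▸ Nat.card_pos)
  have hdisj : Pairwise fun i i' =>
      Disjoint {P' : Place k F | P'.LiesOver (Q i)} {P' : Place k F | P'.LiesOver (Q i')} :=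
    fun _ _ hii' => Set.disjoint_left.2 fun _ h h' => hii' (hQ (Place.LiesOver.eq h h'))
  calc n = (Set.range P).ncard := by
        rw [Set.ncard_range_of_injective hP, Nat.card_fin]
    _ = (⋃ i, {P' : Place k F | P'.LiesOver (Q i)}).ncard := by rw [hPQ, Set.ofPred_exists]
    _ = ∑ i, {P' : Place k F | P'.LiesOver (Q i)}.ncard := by
        rw [Set.ncard_iUnion_of_finite hfin hdisj, finsum_eq_sum_of_fintype]
    _ = s * Nat.card G := by simp only [fun i => (hQsplit i).ncard_eq, Finset.sum_const,
        Finset.card_univ, Fintype.card_fin, smul_eq_mul]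

/-- Evaluation at places where all functions of `V` have values, as a linear map on `V`. -/
def evaluationₗ {V : Submodule k F} (hV : ∀ g ∈ V, ∀ j, (P j).HasValue g (evaluation P g j)) :
    V →ₗ[k] Fin n → k where
  toFun g := evaluation P g
  map_add' g g' := funext fun j =>
    (Place.mk_mem_valueGraph.1 <| (P j).valueGraph.add_mem
      (Place.mk_mem_valueGraph.2 (hV g g.2 j)) (Place.mk_mem_valueGraph.2 (hV g' g'.2 j))).value_eq
  map_smul' c g := funext fun j =>
    (Place.mk_mem_valueGraph.1 <|
      (P j).valueGraph.smul_mem (Place.mk_mem_valueGraph.2 (hV g g.2 j)) c).value_eq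

theorem IsFunctionField.sub_degree_le_hammingNorm [DecidableEq k] (hF : IsFunctionField k F)
    (hP : Function.Injective P) {D : Divisor k F} (hD : 0 ≤ D) {g : F}
    (hg : g ∈ riemannRochSpace D) (hg0 : g ≠ 0)
    (hval : ∀ j, (P j).HasValue g (evaluation P g j)) :
    (n : ℤ) - D.degree ≤ hammingNorm (evaluation P g) := by
  classical
  have hzeros := hF.card_zeros_le_degree hD hg hg0
    (S := (Finset.univ.filter fun j => evaluation P g j = 0).image P) fun P' hP' => by
      obtain ⟨j, hj, rfl⟩ := Finset.mem_image.1 hP'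
      rw [← Place.hasValue_zero_iff, ← (Finset.mem_filter.1 hj).2]
      exact hval j
  have hcard := Finset.card_filter_add_card_filter_not (s := (Finset.univ : Finset (Fin n)))
    fun j => evaluation P g j = 0
  rw [Finset.card_image_of_injective _ hP] at hzeros
  rw [Finset.card_univ, Fintype.card_fin] at hcard
  simp only [hammingNorm, ne_eq]
  omega

variable {j : Fin n}

theorem orbit_subset_range {G H : Subgroup (F ≃ₐ[k] F)} (hHG : H ≤ G) {s : ℕ}
    {Q : Fin s → Place k (IntermediateField.fixedField G)}
    (hPQ : Set.range P = {P' | ∃ i, P'.LiesOver (Q i)}) :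
    Place.orbit H (P j) ⊆ Set.range P := by
  obtain ⟨i, hi⟩ : P j ∈ {P' | ∃ i, P'.LiesOver (Q i)} := hPQ ▸ Set.mem_range_self j
  rw [Place.orbit_eq, hPQ]
  rintro _ ⟨σ, rfl⟩
  exact ⟨i, hi.smul (⟨σ, hHG σ.2⟩ : G)⟩

theorem evaluation_eq_zero_of_recoveringSet {H : Subgroup (F ≃ₐ[k] F)} [Finite H] {r m : ℕ}
    (hr : 1 ≤ r) (hcard : (Place.orbit H (P j)).ncard = r + 1)
    (horbit : Place.orbit H (P j) ⊆ Set.range P) (hrat : ∀ l, (P l).IsRational)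
    {A : Divisor k (IntermediateField.fixedField H)} (hA : 0 ≤ A) {w : F}
    (hpole : ∀ l, ((r : ℤ) - 1) * (P l).poleOrder w + A.conormCoeff (P l) ≤ 0)
    (hw : Set.InjOn (fun P' : Place k F => P'.extValue w) (Place.orbit H (P j)))
    {f : Fin m → riemannRochSpace A} {g : F}
    (hg : g ∈ functionSpace (k := k) (fun i => ((f i : IntermediateField.fixedField H) : F)) w r)
    (hval : ∀ l, (P l).HasValue g (evaluation P g l))
    (h0 : ∀ l ∈ recoveringSet P H j, evaluation P g l = 0) : evaluation P g j = 0 := by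
  refine (hval j).unique (Place.hasValue_zero_of_mem_functionSpace hr hA hcard.ge
    (fun P' hP' => ?_) (fun P' hP' => ?_) hw hg fun P' hP' hne => ?_) <;>
    obtain ⟨l, rfl⟩ := horbit hP'
  · exact hrat l
  · exact hpole l
  · have hl := hval l
    rwa [h0 l (mem_recoveringSet.2 ⟨fun hlj => hne (hlj ▸ rfl), hP'⟩)] at hl

end Code

section Code

variable {n : ℕ} {P : Fin n → Place k F}

theorem hasValue_evaluation_of_mem_riemannRochSpace {D : Divisor k F} {g : F}
    (hrat : ∀ j, (P j).IsRational) (hD : ∀ j, P j ∉ D.support) (hg : g ∈ riemannRochSpace D)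
    (j : Fin n) : (P j).HasValue g (evaluation P g j) := by
  refine (hrat j).hasValue_value ((mem_riemannRochSpace_iff.1 hg (P j)).trans_eq ?_)
  rw [Finsupp.notMem_support_iff.1 (hD j), WithZero.exp_zero]

theorem coe_range_evaluationₗ {V : Submodule k F}
    (hV : ∀ g ∈ V, ∀ j, (P j).HasValue g (evaluation P g j)) :
    ((evaluationₗ hV).range : Set (Fin n → k)) = evaluation P '' (V : Set F) := by
  ext c
  simp [evaluationₗ]

open Classical in
theorem isLRC_range_evaluationₗ {V : Submodule k F} (hV0 : V ≠ ⊥)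
    (hval : ∀ g ∈ V, ∀ j, (P j).HasValue g (evaluation P g j)) {d : ℕ} (hd : 1 ≤ d)
    (hnorm : ∀ g ∈ V, g ≠ 0 → d ≤ hammingNorm (evaluation P g)) {t : ℕ} {r : Fin t → ℕ}
    (I : Fin t → Fin n → Finset (Fin n))
    (hdisj : ∀ j, Pairwise fun i i' => Disjoint (I i j) (I i' j))
    (hmem : ∀ i j, j ∉ I i j) (hcard : ∀ i j, (I i j).card ≤ r i)
    (hrec : ∀ i j, ∀ g ∈ V, (∀ l ∈ I i j, evaluation P g l = 0) → evaluation P g j = 0) :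
    IsLRC (evaluationₗ hval).range (Module.finrank k V) d r := by
  have hinj : Function.Injective (evaluationₗ hval) :=
    (injective_iff_map_eq_zero _).2 fun g hg => by
      by_contra hg0
      have hdist := hnorm g g.2 fun h => hg0 (Subtype.ext h)
      rw [show evaluation P g = 0 from hg, hammingNorm_zero] at hdist
      omega
  refine ⟨LinearMap.finrank_range_of_inj hinj, le_minDist ?_ ?_,
    isLocallyRepairable I hdisj hmem hcard ?_⟩
  · obtain ⟨g, hg, hg0⟩ := V.exists_mem_ne_zero_of_ne_bot hV0
    refine (Submodule.ne_bot_iff _).2 ⟨_, ⟨⟨g, hg⟩, rfl⟩, fun h0 => hg0 ?_⟩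
    exact congrArg Subtype.val (hinj (h0.trans (map_zero _).symm))
  · rintro _ ⟨g, rfl⟩ hg0
    exact hnorm g g.2 fun h => hg0 (by rw [Subtype.ext (a1 := g) (a2 := 0) h, map_zero])
  · rintro i j _ ⟨g, rfl⟩ h0
    exact hrec i j g g.2 h0

end Code

end FunctionFieldCode

end

open FunctionFieldCode in
theorem proposition3p1_general
    {k F : Type*} [Field k] [Field F] [Algebra k F] (hF : IsFunctionField k F)
    {t : ℕ} [NeZero t] (r : Fin t → ℕ) (hr : ∀ i, 1 ≤ r i)
    (H : Fin t → Subgroup (F ≃ₐ[k] F)) (hH : ∀ i, Nat.card (H i) = r i + 1)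
    (G : Subgroup (F ≃ₐ[k] F)) (hHG : ∀ i, H i ≤ G)
    (hinf : Pairwise fun i i' => H i ⊓ H i' = ⊥)
    (s : ℕ) (Q : Fin s → Place k (IntermediateField.fixedField G)) (hQ : Function.Injective Q)
    (hQrat : ∀ i, (Q i).IsRational) (hQsplit : ∀ i, (Q i).SplitsCompletely)
    (n : ℕ) (P : Fin n → Place k F) (hP : Function.Injective P)
    (hPQ : Set.range P = {P' | ∃ i, P'.LiesOver (Q i)})
    (w : Fin t → F)
    (hw : ∀ i j, Set.InjOn (fun P' : Place k F => P'.extValue (w i)) (Place.orbit (H i) (P j)))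
    (d : ℕ) (hd : 1 ≤ d)
    (D : Divisor k F) (hD : 0 ≤ D) (hDdeg : D.degree ≤ (n : ℤ) - d)
    (hDsupp : ∀ j, P j ∉ D.support)
    (A : ∀ i, Divisor k (IntermediateField.fixedField (H i))) (hA : ∀ i, 0 ≤ A i)
    (hAD : ∀ i, ∀ P' : Place k F,
      ((r i : ℤ) - 1) * P'.poleOrder (w i) + (A i).conormCoeff P' ≤ D P')
    (m : Fin t → ℕ) (f : ∀ i, Fin (m i) → riemannRochSpace (A i))
    (V : Submodule k F) (hV0 : V ≠ ⊥)
    (hV : ∀ i, V ≤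
      functionSpace (fun j => ((f i j : IntermediateField.fixedField (H i)) : F)) (w i) (r i)) :
    n = s * Nat.card G ∧
    (∀ i, functionSpace (k := k) (fun j => ((f i j : IntermediateField.fixedField (H i)) : F))
      (w i) (r i) ≤ riemannRochSpace D) ∧
    (∀ j, (P j).IsRational ∧ ∀ g ∈ V, (P j).HasValue g (evaluation P g j)) ∧
    ∃ C : Submodule k (Fin n → k), (C : Set (Fin n → k)) = evaluation P '' (V : Set F) ∧
      IsLRC C (Module.finrank k V) d r := by
  classical
  have hfinite (i) : Finite (H i) := Nat.finite_of_card_ne_zero (by rw [hH i]; omega)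
  have hVD (i) := functionSpace_le_riemannRochSpace (f := f i) (hAD i)
  have hover (j) : ∃ i, (P j).LiesOver (Q i) := hPQ.le (Set.mem_range_self j)
  have hrat (j) : (P j).IsRational :=
    let ⟨i, hi⟩ := hover j; (hQsplit i).isRational (hQrat i) hi
  have hstab (j) : ∀ σ ∈ G, σ • P j = P j → σ = 1 :=
    let ⟨i, hi⟩ := hover j; fun _ hσ => (hQsplit i).eq_one_of_smul_eq hi hσ
  have hVD' (g) (hg : g ∈ V) : g ∈ riemannRochSpace D := hVD 0 (hV 0 hg)
  have hval (g) (hg : g ∈ V) :=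
    hasValue_evaluation_of_mem_riemannRochSpace hrat hDsupp (hVD' g hg)
  have hcard (i j) : (Place.orbit (H i) (P j)).ncard = r i + 1 := by
    rw [Place.orbit_eq, ncard_orbit fun σ hσ => hstab j σ (hHG i hσ), hH]
  refine ⟨card_eq_mul_card_of_splitsCompletely hQ hQsplit hP hPQ, hVD,
    fun j => ⟨hrat j, fun g hg => hval g hg j⟩, _, coe_range_evaluationₗ hval, ?_⟩
  refine isLRC_range_evaluationₗ hV0 hval hd (fun g hg hg0 => ?_) (fun i => recoveringSet P (H i))
    (fun j i i' hii' => disjoint_recoveringSet hP (hHG i) (hHG i') (hinf hii') (hstab j))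
    (fun i j hj => (mem_recoveringSet.1 hj).1 rfl)
    (fun i j => card_recoveringSet_le hP (hcard i j)) (fun i j g hg => ?_)
  · have := hF.sub_degree_le_hammingNorm hP hD (hVD' g hg) hg0 (hval g hg)
    omega
  · exact evaluation_eq_zero_of_recoveringSet (hr i) (hcard i j)
      (orbit_subset_range (hHG i) hPQ) hrat (hA i)
      (fun l => (hAD i (P l)).trans_eq (Finsupp.notMem_support_iff.1 (hDsupp l))) (hw i j)
      (hV i hg) (hval g hg)

open FunctionFieldCode in
theorem proposition3p1
    {k F : Type*} [Field k] [Finite k] [Field F] [Algebra k F] (hF : IsFunctionField k F)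
    -- the subgroups `H₁ = H 0`, `H₂ = H 1` of orders `r₁ + 1`, `r₂ + 1`, and `G = H₁ ⋊ H₂`
    (r : Fin 2 → ℕ) (hr : ∀ i, 1 ≤ r i)
    (H : Fin 2 → Subgroup (F ≃ₐ[k] F)) (hH : ∀ i, Nat.card (H i) = r i + 1)
    (G : Subgroup (F ≃ₐ[k] F)) (hG : IsSemidirectProduct G (H 0) (H 1))
    -- rational places `Q_1, …, Q_s` of `E = F^G` that split completely in `F`
    (s : ℕ) (Q : Fin s → Place k (IntermediateField.fixedField G)) (hQ : Function.Injective Q)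
    (hQrat : ∀ i, (Q i).IsRational) (hQsplit : ∀ i, (Q i).SplitsCompletely)
    -- the evaluation places `P_1, …, P_n`: an enumeration of the places of `F` over the `Q_i`
    (n : ℕ) (P : Fin n → Place k F) (hP : Function.Injective P)
    (hPQ : Set.range P = {P' | ∃ i, P'.LiesOver (Q i)})
    -- the functions `w₁`, `w₂`
    (w : Fin 2 → F)
    (hw_indep : ∀ i, LinearIndependent (IntermediateField.fixedField (H i))
      (fun l : Fin (r i) => w i ^ (l : ℕ)))
    (hw_eval : ∀ i j, Set.InjOn (fun P' : Place k F => P'.extValue (w i))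
      (Place.orbit (H i) (P j)))
    -- the designed distance `d` and the divisor `D`
    (d : ℕ) (hd : 1 ≤ d) (hdn : d ≤ n)
    (D : Divisor k F) (hD : 0 ≤ D) (hDdeg : Divisor.degree D = (n : ℤ) - d)
    (hDsupp : ∀ j, P j ∉ D.support)
    (hDw : ∀ i, ∀ P' : Place k F, ((r i : ℤ) - 1) * P'.poleOrder (w i) ≤ D P')
    -- the largest effective divisors `D₁`, `D₂` of `F₁`, `F₂` with
    -- `(r_i - 1) (w_i)_∞ + Conorm(D_i) ≤ D`
    (D' : ∀ i, Divisor k (IntermediateField.fixedField (H i)))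
    (hD' : ∀ i, IsGreatest {A : Divisor k (IntermediateField.fixedField (H i)) | 0 ≤ A ∧
      ∀ P' : Place k F,
        ((r i : ℤ) - 1) * P'.poleOrder (w i) + Divisor.conormCoeff A P' ≤ D P'} (D' i))
    -- bases of `L(D₁)`, `L(D₂)`
    (m : Fin 2 → ℕ) (f : ∀ i, Module.Basis (Fin (m i)) k (riemannRochSpace (D' i)))
    -- the spaces `V₁`, `V₂` and `V = V₁ ∩ V₂`
    (V₁ V₂ V : Submodule k F)
    (hV₁ : V₁ = functionSpace (fun j => ((f 0 j : IntermediateField.fixedField (H 0)) : F))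
      (w 0) (r 0))
    (hV₂ : V₂ = functionSpace (fun j => ((f 1 j : IntermediateField.fixedField (H 1)) : F))
      (w 1) (r 1))
    (hV : V = V₁ ⊓ V₂) (hV0 : V ≠ ⊥) :
    n = s * ((r 0 + 1) * (r 1 + 1)) ∧
    V₁ ≤ riemannRochSpace D ∧ V₂ ≤ riemannRochSpace D ∧
    (∀ j, (P j).IsRational ∧ ∀ g ∈ V, (P j).HasValue g (evaluation P g j)) ∧
    ∃ C : Submodule k (Fin n → k), (C : Set (Fin n → k)) = evaluation P '' (V : Set F) ∧
      IsLRC C (Module.finrank k V) d r := by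
  have hinf : Pairwise fun i i' => H i ⊓ H i' = ⊥ := by
    simp [Pairwise, Fin.forall_fin_two, hG.inf_eq, inf_comm]
  subst hV₁ hV₂ hV
  simpa only [hG.card_eq, hH, Fin.forall_fin_two, and_assoc] using
    proposition3p1_general hF r hr H hH G (Fin.forall_fin_two.2 ⟨hG.le_left, hG.le_right⟩) hinf
      s Q hQ hQrat hQsplit n P hP hPQ w hw_eval d hd D hD hDdeg.le hDsupp D'
      (fun i => (hD' i).1.1) (fun i => (hD' i).1.2) m (fun i => f i) _ hV0
      (Fin.forall_fin_two.2 ⟨inf_le_left, inf_le_right⟩)
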